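/- Let $N$ be a finitely generated torsion-free nilpotent group. A rational Mal'cev completion of $N$ is a nilpotent group $N_{\mathbb{Q}}$ containing $N$ as a subgroup, such that for every integer $k\ge 1$ each element of $N_{\mathbb{Q}}$ has a unique $k$-th root in $N_{\mathbb{Q}}$, and every element of $N_{\mathbb{Q}}$ has a positive power lying in $N$. The abstract commensurator $\mathrm{Comm}(N)$ is the group of equivalence classes of isomorphisms $\alpha\colon H\to J$ between subgroups $H,J$ of finite index in $N$, where $\alpha$ and $\alpha'$ are equivalent if they agree on some common subgroup of finite index, and where the product of the classes of $\alpha$ and $\beta$ is the class of the partially defined composite $\alpha\circ\beta$. Then $N$ has a rational Mal'cev completion, and for every rational Mal'cev completion $N_{\mathbb{Q}}$ of $N$ there is an isomorphism of groups $$\mathrm{Comm}(N)\cong \mathrm{Aut}(N_{\mathbb{Q}}).$$ -/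

import Mathlib

universe u v

/-- A partial isomorphism of a group `G`: an isomorphism `toEquiv : dom ≃* cod` between two
subgroups of finite index in `G`. -/
structure PartialIso (G : Type u) [Group G] where
  dom : Subgroup G
  cod : Subgroup G
  finiteIndex_dom : dom.FiniteIndex
  finiteIndex_cod : cod.FiniteIndex
  toEquiv : dom ≃* cod

namespace PartialIso

variable {G : Type u} [Group G]

/-- Two partial isomorphisms are equivalent if they agree on some common subgroup of finite
index. -/
def Equivalent (α β : PartialIso G) : Prop :=
  ∃ K : Subgroup G, K.FiniteIndex ∧ ∃ (hα : K ≤ α.dom) (hβ : K ≤ β.dom),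
    ∀ (x : G) (hx : x ∈ K), (α.toEquiv ⟨x, hα hx⟩ : G) = β.toEquiv ⟨x, hβ hx⟩

/-- The subgroup `{x ∈ H | e x ∈ A}` of `G`, for an isomorphism `e : H ≃* J` of subgroups. -/
def pull {H J : Subgroup G} (e : H ≃* J) (A : Subgroup G) : Subgroup G :=
  (A.comap (J.subtype.comp e.toMonoidHom)).map H.subtype

theorem mem_pull {H J : Subgroup G} (e : H ≃* J) (A : Subgroup G) (x : G) :
    x ∈ pull e A ↔ ∃ h : x ∈ H, (e ⟨x, h⟩ : G) ∈ A := by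
  simp [pull, Subgroup.mem_map]

theorem finiteIndex_pull {H J : Subgroup G} (e : H ≃* J) (A : Subgroup G)
    (hH : H.FiniteIndex) (hA : A.FiniteIndex) : (pull e A).FiniteIndex := by
  refine ⟨?_⟩
  rw [pull, Subgroup.index_map_subtype, Subgroup.index_comap]
  exact mul_ne_zero (fun h => hA.index_ne_zero (Subgroup.index_eq_zero_of_relIndex_eq_zero h))
    hH.index_ne_zero

/-- The identity of `G`. -/
def id (G : Type u) [Group G] : PartialIso G where
  dom := ⊤
  cod := ⊤
  finiteIndex_dom := inferInstance
  finiteIndex_cod := inferInstance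
  toEquiv := MulEquiv.refl _

/-- The inverse of a partial isomorphism. -/
def symm (α : PartialIso G) : PartialIso G where
  dom := α.cod
  cod := α.dom
  finiteIndex_dom := α.finiteIndex_cod
  finiteIndex_cod := α.finiteIndex_dom
  toEquiv := α.toEquiv.symm

/-- The partially defined composite `α ∘ β` (first `β`, then `α`), with domain
`{x ∈ β.dom | β x ∈ α.dom}`. -/
def comp (α β : PartialIso G) : PartialIso G where
  dom := pull β.toEquiv α.dom
  cod := pull α.toEquiv.symm β.cod
  finiteIndex_dom := finiteIndex_pull _ _ β.finiteIndex_dom α.finiteIndex_dom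
  finiteIndex_cod := finiteIndex_pull _ _ α.finiteIndex_cod β.finiteIndex_cod
  toEquiv :=
    { toFun := fun x =>
        ⟨α.toEquiv ⟨β.toEquiv ⟨x, ((mem_pull _ _ _).1 x.2).1⟩, ((mem_pull _ _ _).1 x.2).2⟩,
          (mem_pull _ _ _).2 ⟨Subtype.property _, by simp⟩⟩
      invFun := fun y =>
        ⟨β.toEquiv.symm ⟨α.toEquiv.symm ⟨y, ((mem_pull _ _ _).1 y.2).1⟩,
            ((mem_pull _ _ _).1 y.2).2⟩,
          (mem_pull _ _ _).2 ⟨Subtype.property _, by simp⟩⟩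
      left_inv := fun x => by simp
      right_inv := fun y => by simp
      map_mul' := fun x y => by
        apply Subtype.ext
        have h1 := ((mem_pull _ _ _).1 x.2)
        have h2 := ((mem_pull _ _ _).1 y.2)
        have e1 : β.toEquiv ⟨(x : G) * y, mul_mem h1.1 h2.1⟩
            = β.toEquiv ⟨x, h1.1⟩ * β.toEquiv ⟨y, h2.1⟩ := by
          rw [← map_mul]; rfl
        simp only [Subgroup.coe_mul, e1]
        refine Eq.trans ?_ (congrArg Subtype.val
          (map_mul α.toEquiv ⟨β.toEquiv ⟨x, h1.1⟩, h1.2⟩ ⟨β.toEquiv ⟨y, h2.1⟩, h2.2⟩))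
        rfl }

theorem equivalent_refl (α : PartialIso G) : Equivalent α α :=
  ⟨α.dom, α.finiteIndex_dom, le_rfl, le_rfl, fun _ _ => rfl⟩

theorem equivalent_symm {α β : PartialIso G} (h : Equivalent α β) : Equivalent β α := by
  obtain ⟨K, hK, h1, h2, h⟩ := h
  exact ⟨K, hK, h2, h1, fun x hx => (h x hx).symm⟩

theorem equivalent_trans {α β γ : PartialIso G} (h : Equivalent α β) (h' : Equivalent β γ) :
    Equivalent α γ := by
  obtain ⟨K, hK, h1, h2, h⟩ := h
  obtain ⟨K', hK', h1', h2', h'⟩ := h'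
  exact ⟨K ⊓ K', inferInstance, inf_le_left.trans h1, inf_le_right.trans h2',
    fun x hx => (h x hx.1).trans (h' x hx.2)⟩

instance setoid (G : Type u) [Group G] : Setoid (PartialIso G) where
  r := Equivalent
  iseqv := ⟨equivalent_refl, equivalent_symm, equivalent_trans⟩

theorem comp_congr {α α' β β' : PartialIso G} (h : Equivalent α α') (h' : Equivalent β β') :
    Equivalent (comp α β) (comp α' β') := by
  obtain ⟨K, hK, h1, h2, h⟩ := h
  obtain ⟨L, hL, h1', h2', h'⟩ := h'
  have key : ∀ x ∈ L ⊓ pull β.toEquiv K, ∃ (a : x ∈ β.dom) (b : x ∈ β'.dom),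
      (β.toEquiv ⟨x, a⟩ : G) ∈ K ∧ (β.toEquiv ⟨x, a⟩ : G) = β'.toEquiv ⟨x, b⟩ := by
    rintro x ⟨hx, hx'⟩
    obtain ⟨a, ha⟩ := (mem_pull _ _ _).1 hx'
    exact ⟨a, h2' hx, ha, h' x hx⟩
  have := finiteIndex_pull β.toEquiv K β.finiteIndex_dom hK
  refine ⟨L ⊓ pull β.toEquiv K, inferInstance, ?_, ?_, ?_⟩
  · intro x hx
    obtain ⟨a, b, c, d⟩ := key x hx
    exact (mem_pull _ _ _).2 ⟨a, h1 c⟩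
  · intro x hx
    obtain ⟨a, b, c, d⟩ := key x hx
    exact (mem_pull _ _ _).2 ⟨b, h2 (d ▸ c)⟩
  · intro x hx
    obtain ⟨a, b, c, d⟩ := key x hx
    change (α.toEquiv ⟨β.toEquiv ⟨x, _⟩, _⟩ : G) = α'.toEquiv ⟨β'.toEquiv ⟨x, _⟩, _⟩
    rw [h _ c]
    congr 3

theorem symm_congr {α β : PartialIso G} (h : Equivalent α β) :
    Equivalent (symm α) (symm β) := by
  obtain ⟨K, hK, h1, h2, h⟩ := h
  have key : ∀ y ∈ pull α.toEquiv.symm K, ∃ (a : y ∈ α.cod) (b : y ∈ β.cod),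
      (α.toEquiv.symm ⟨y, a⟩ : G) = β.toEquiv.symm ⟨y, b⟩ := by
    intro y hy
    obtain ⟨a, ha⟩ := (mem_pull _ _ _).1 hy
    have e := h _ ha
    simp only [Subtype.coe_eta, MulEquiv.apply_symm_apply] at e
    have b : y ∈ β.cod := by rw [e]; exact Subtype.property _
    refine ⟨a, b, ?_⟩
    have e' : (⟨y, b⟩ : β.cod) = β.toEquiv ⟨α.toEquiv.symm ⟨y, a⟩, h2 ha⟩ := Subtype.ext e
    rw [e']
    simp
  refine ⟨pull α.toEquiv.symm K, finiteIndex_pull _ _ α.finiteIndex_cod hK,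
    fun y hy => (key y hy).1, fun y hy => (key y hy).2.1, fun y hy => (key y hy).2.2⟩

end PartialIso

/-- The abstract commensurator of `G`: equivalence classes of isomorphisms between subgroups of
finite index in `G`. -/
def Comm (G : Type u) [Group G] : Type u := Quotient (PartialIso.setoid G)

namespace Comm

/-- The product of the classes of `α` and `β` is the class of the partially defined composite
`α ∘ β`. -/
instance group (G : Type u) [Group G] : Group (Comm G) where
  one := Quotient.mk _ (PartialIso.id G)
  mul := Quotient.map₂ PartialIso.comp
    (fun _ _ h _ _ h' => PartialIso.comp_congr h h')
  inv := Quotient.map PartialIso.symm (fun _ _ h => PartialIso.symm_congr h)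
  mul_assoc := by
    rintro ⟨α⟩ ⟨β⟩ ⟨γ⟩
    apply Quotient.sound
    refine ⟨((α.comp β).comp γ).dom, ((α.comp β).comp γ).finiteIndex_dom, le_rfl, ?_, ?_⟩
    · intro x hx
      obtain ⟨a, ha⟩ := (PartialIso.mem_pull _ _ _).1 hx
      obtain ⟨b, hb⟩ := (PartialIso.mem_pull _ _ _).1 ha
      exact (PartialIso.mem_pull _ _ _).2 ⟨(PartialIso.mem_pull _ _ _).2 ⟨a, b⟩, hb⟩
    · intro x hx
      rfl
  one_mul := by
    rintro ⟨α⟩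
    apply Quotient.sound
    refine ⟨α.dom, α.finiteIndex_dom, ?_, le_rfl, fun x hx => rfl⟩
    intro x hx
    exact (PartialIso.mem_pull _ _ _).2 ⟨hx, Subgroup.mem_top _⟩
  mul_one := by
    rintro ⟨α⟩
    apply Quotient.sound
    refine ⟨α.dom, α.finiteIndex_dom, ?_, le_rfl, fun x hx => rfl⟩
    intro x hx
    exact (PartialIso.mem_pull _ _ _).2 ⟨Subgroup.mem_top _, hx⟩
  inv_mul_cancel := by
    rintro ⟨α⟩
    apply Quotient.sound
    refine ⟨α.dom, α.finiteIndex_dom, ?_, le_top, fun x hx => ?_⟩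
    · intro x hx
      exact (PartialIso.mem_pull _ _ _).2 ⟨hx, Subtype.property _⟩
    · change (α.toEquiv.symm (α.toEquiv ⟨x, hx⟩) : G) = x
      simp

end Comm

/-- `ι : N →* M` exhibits `M` as a rational Mal'cev completion of the torsion-free nilpotent
group `N`: it embeds `N` in a nilpotent, uniquely divisible group `M`, every element of which
has a positive power in (the image of) `N`. -/
structure IsRationalMalcevCompletion {N : Type u} {M : Type v} [Group N] [Group M]
    (ι : N →* M) : Prop where
  isNilpotent : Group.IsNilpotent M
  uniquelyDivisible : ∀ k : ℕ, 0 < k → Function.Bijective (fun x : M => x ^ k)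
  injective : Function.Injective ι
  exists_pow_mem : ∀ x : M, ∃ k : ℕ, 0 < k ∧ x ^ k ∈ ι.range

/-! An automorphism `φ` of a completion `M` restricts to a partial isomorphism on the elements of
`N` that `φ` maps into `N`. Each element of `N` has a power there, so in a finitely generated
nilpotent group this domain has finite index (`finiteIndex_of_exists_pow_mem`). The resulting map to
`Comm N` is injective because every element of `M` is a root of an element of any given finite-index
subgroup, and roots are unique. For surjectivity, view a partial isomorphism as a subgroup of `M ×
M`, namely its graph. In a nilpotent group the elements with a power in a given subgroup form a
subgroup, its isolator, and unique roots make the isolator of the graph the graph of an automorphism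
(`exists_mulAut_of_injective`).

For existence, `N` is embedded in a unipotent group over `ℚ`. It acts on the rational polynomial
functions on `N` of bounded degree. Degree is lowered by each `g - 1`, so the action is unipotent,
and it is faithful once polynomials separate points. Separation is proved along a chain of isolated
normal subgroups with infinite cyclic quotients; the hard step extends a polynomial from `H` to
`H⟨t⟩` (`map_sub_mem_weightedFiltration`). Filtered unipotent units form a nilpotent torsion-free
group with roots, and the isolator of `N` in it is the completion. -/

open scoped commutatorElement

/-! ### Commutators with central values -/

theorem commutatorElement_pow_left_of_central {G : Type*} [Group G] {u q : G}
    (hc : ⁅u, q⁆ ∈ Subgroup.center G) (k : ℕ) : ⁅u ^ k, q⁆ = ⁅u, q⁆ ^ k := by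
  induction k with
  | zero => simp
  | succ k ih =>
    rw [pow_succ' u, commutatorElement_mul_left_eq_conj_mul, ih,
      Subgroup.mem_center_iff.1 (pow_mem hc k) u, pow_succ]
    group

theorem commutatorElement_pow_right_of_central {G : Type*} [Group G] {u q : G}
    (hc : ⁅u, q⁆ ∈ Subgroup.center G) (k : ℕ) : ⁅u, q ^ k⁆ = ⁅u, q⁆ ^ k := by
  have hc' : ⁅q, u⁆ ∈ Subgroup.center G := by
    rw [← commutatorElement_inv]; exact inv_mem hc
  rw [← commutatorElement_inv, commutatorElement_pow_left_of_central hc', ← inv_pow,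
    commutatorElement_inv]

theorem commutatorElement_mul_central {G : Type*} [Group G] {v w y z : G}
    (hy : y ∈ Subgroup.center G) (hz : z ∈ Subgroup.center G) :
    ⁅v * y, w * z⁆ = ⁅v, w⁆ := by
  rw [Subgroup.mem_center_iff] at hy hz
  have h1 : ⁅v * y, w * z⁆ = v * (y * (w * z)) * (y⁻¹ * v⁻¹) * (z⁻¹ * w⁻¹) := by
    simp only [commutatorElement_def]; group
  rw [h1, ← hy (w * z)]
  have h2 : v * (w * z * y) * (y⁻¹ * v⁻¹) * (z⁻¹ * w⁻¹) = v * w * (z * v⁻¹) * (z⁻¹ * w⁻¹) := by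
    group
  rw [h2, ← hz v⁻¹, commutatorElement_def]
  group

theorem lowerCentralSeries_le_center {G : Type*} [Group G] {n : ℕ}
    (h : (⊤ : Subgroup G).lowerCentralSeries (n + 1) = ⊥) :
    (⊤ : Subgroup G).lowerCentralSeries n ≤ Subgroup.center G := by
  rw [Subgroup.lowerCentralSeries_succ] at h
  rwa [Subgroup.commutator_eq_bot_iff_le_centralizer, Subgroup.coe_top,
    Subgroup.centralizer_univ] at h

theorem lowerCentralSeries_quotient_eq_bot {G : Type*} [Group G] (n : ℕ) :
    (⊤ : Subgroup (G ⧸ (⊤ : Subgroup G).lowerCentralSeries n)).lowerCentralSeries n = ⊥ := by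
  have h := Subgroup.map_lowerCentralSeries (⊤ : Subgroup G)
    (QuotientGroup.mk' ((⊤ : Subgroup G).lowerCentralSeries n)) n
  rw [Subgroup.map_top_of_surjective _ (QuotientGroup.mk'_surjective _)] at h
  rw [← h, Subgroup.map_eq_bot_iff, QuotientGroup.ker_mk']

/-! ### Isolators in nilpotent groups -/

/-- Induction on the class: modulo the last central term `A`, every element has a power in the image
of `N`. The elements of `A` are then handled through commutators, which are bimultiplicative when
their values are central. -/
theorem exists_pow_mem_of_closure_aux (n : ℕ) : ∀ (G : Type u) [Group G],
    (⊤ : Subgroup G).lowerCentralSeries n = ⊥ → ∀ (N : Subgroup G) (S : Set G),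
    Subgroup.closure S = ⊤ → (∀ s ∈ S, ∃ k : ℕ, 0 < k ∧ s ^ k ∈ N) →
    ∀ g : G, ∃ k : ℕ, 0 < k ∧ g ^ k ∈ N := by
  induction n with
  | zero =>
    intro G _ h N S _ _ g
    have : g ∈ (⊥ : Subgroup G) := by
      rw [← h, Subgroup.lowerCentralSeries_zero]; trivial
    rw [Subgroup.mem_bot] at this
    exact ⟨1, one_pos, by simp [this]⟩
  | succ n ih =>
    intro G _ h N S hS hSN
    set A := (⊤ : Subgroup G).lowerCentralSeries n with hA
    have hAc : A ≤ Subgroup.center G := lowerCentralSeries_le_center h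
    have mul_central : ∀ a b : G, b ∈ Subgroup.center G → (∃ k : ℕ, 0 < k ∧ a ^ k ∈ N) →
        (∃ k : ℕ, 0 < k ∧ b ^ k ∈ N) → ∃ k : ℕ, 0 < k ∧ (a * b) ^ k ∈ N := by
      rintro a b hb ⟨k, hk, hka⟩ ⟨l, hl, hlb⟩
      refine ⟨k * l, Nat.mul_pos hk hl, ?_⟩
      have hc : Commute a b := Subgroup.mem_center_iff.1 hb a
      rw [hc.mul_pow]
      refine mul_mem ?_ ?_
      · rw [pow_mul]; exact pow_mem hka l
      · rw [mul_comm, pow_mul]; exact pow_mem hlb k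
    have inv_aux : ∀ a : G, (∃ k : ℕ, 0 < k ∧ a ^ k ∈ N) → ∃ k : ℕ, 0 < k ∧ a⁻¹ ^ k ∈ N := by
      rintro a ⟨k, hk, hka⟩
      exact ⟨k, hk, by rw [inv_pow]; exact inv_mem hka⟩
    -- For `n = 0` the term `A` is all of `G`, which is abelian, and `A` need not be generated by
    -- commutators.
    rcases n with _ | m
    · intro g
      have hg : g ∈ Subgroup.closure S := by rw [hS]; trivial
      induction hg using Subgroup.closure_induction with
      | mem x hx => exact hSN x hx
      | one => exact ⟨1, one_pos, by simp⟩
      | mul x y _ _ hx hy =>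
        exact mul_central x y (hAc (by rw [hA, Subgroup.lowerCentralSeries_zero]; trivial)) hx hy
      | inv x _ hx => exact inv_aux x hx
    · have key : ∀ g : G, ∃ k : ℕ, 0 < k ∧ ∃ v ∈ N, ∃ z ∈ A, g ^ k = v * z := by
        intro g
        obtain ⟨k, hk, hg⟩ := ih (G ⧸ A) (lowerCentralSeries_quotient_eq_bot (m + 1))
          (N.map (QuotientGroup.mk' A)) (QuotientGroup.mk' A '' S)
          (by rw [← MonoidHom.map_closure, hS,
                Subgroup.map_top_of_surjective _ (QuotientGroup.mk'_surjective _)])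
          (by
            rintro _ ⟨s, hs, rfl⟩
            obtain ⟨k, hk, hks⟩ := hSN s hs
            exact ⟨k, hk, s ^ k, hks, by simp⟩) (QuotientGroup.mk' A g)
        obtain ⟨v, hv, hvg⟩ := hg
        refine ⟨k, hk, v, hv, v⁻¹ * g ^ k, ?_, by group⟩
        rw [← map_pow] at hvg
        exact QuotientGroup.eq.1 hvg
      have hAN : ∀ a ∈ A, ∃ k : ℕ, 0 < k ∧ a ^ k ∈ N := by
        intro a ha
        rw [hA, Subgroup.lowerCentralSeries_succ, Subgroup.commutator_def] at ha
        have hle : ∀ x ∈ {g | ∃ g₁ ∈ (⊤ : Subgroup G).lowerCentralSeries m,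
            ∃ g₂ ∈ (⊤ : Subgroup G), ⁅g₁, g₂⁆ = g}, x ∈ A := by
          rintro x ⟨p, hp, q, hq, rfl⟩
          exact Subgroup.commutator_mem_commutator hp hq
        induction ha using Subgroup.closure_induction with
        | mem x hx =>
          have hxc := hAc (hle x hx)
          obtain ⟨p, hp, q, hq, rfl⟩ := hx
          obtain ⟨k, hk, v, hv, y, hy, e⟩ := key p
          obtain ⟨l, hl, w, hw, z, hz, e'⟩ := key q
          -- `⁅p, q⁆ ^ (k * l) = ⁅p ^ k, q ^ l⁆ = ⁅v * y, w * z⁆ = ⁅v, w⁆`, since `y` and `z` are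
          -- central.
          refine ⟨k * l, Nat.mul_pos hk hl, ?_⟩
          have h1 : ⁅p ^ k, q⁆ = ⁅p, q⁆ ^ k := commutatorElement_pow_left_of_central hxc k
          rw [pow_mul, ← h1, ← commutatorElement_pow_right_of_central (h1 ▸ pow_mem hxc k), e, e',
            commutatorElement_mul_central (hAc hy) (hAc hz), commutatorElement_def]
          exact mul_mem (mul_mem (mul_mem hv hw) (inv_mem hv)) (inv_mem hw)
        | one => exact ⟨1, one_pos, by simp⟩
        | mul x y _ hy hx' hy' =>
          exact mul_central x y (hAc (((Subgroup.closure_le A).2 hle) hy)) hx' hy'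
        | inv x _ hx => exact inv_aux x hx
      intro g
      obtain ⟨k, hk, v, hv, z, hz, e⟩ := key g
      obtain ⟨l, hl, h'⟩ := mul_central v z (hAc hz) ⟨1, one_pos, by simpa using hv⟩ (hAN z hz)
      exact ⟨k * l, Nat.mul_pos hk hl, by rwa [pow_mul, e]⟩

/-- In a nilpotent group generated by elements having a positive power in `N`, every element has
a positive power in `N`. -/
theorem exists_pow_mem_of_closure {G : Type u} [Group G] [Group.IsNilpotent G] (N : Subgroup G)
    (S : Set G) (hS : Subgroup.closure S = ⊤) (hSN : ∀ s ∈ S, ∃ k : ℕ, 0 < k ∧ s ^ k ∈ N)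
    (g : G) : ∃ k : ℕ, 0 < k ∧ g ^ k ∈ N := by
  obtain ⟨n, hn⟩ := Subgroup.nilpotent_iff_lowerCentralSeries.1 ‹Group.IsNilpotent G›
  exact exists_pow_mem_of_closure_aux n G hn N S hS hSN g

/-- The isolator of a subgroup `N` of a nilpotent group: the elements with a positive power
in `N`. -/
def isolator {G : Type u} [Group G] [Group.IsNilpotent G] (N : Subgroup G) : Subgroup G where
  carrier := {g | ∃ k : ℕ, 0 < k ∧ g ^ k ∈ N}
  one_mem' := ⟨1, one_pos, by simp⟩
  inv_mem' := by
    rintro a ⟨k, hk, hka⟩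
    exact ⟨k, hk, by rw [inv_pow]; exact inv_mem hka⟩
  mul_mem' := by
    rintro a b ha hb
    set T := Subgroup.closure ({a, b} : Set G)
    have haT : a ∈ T := Subgroup.subset_closure (by simp)
    have hbT : b ∈ T := Subgroup.subset_closure (by simp)
    obtain ⟨k, hk, h⟩ := exists_pow_mem_of_closure (N.subgroupOf T)
      (((↑) : T → G) ⁻¹' {a, b}) (Subgroup.closure_closure_coe_preimage)
      (by
        rintro ⟨s, hs⟩ hs'
        rcases hs' with h | h
        · obtain ⟨k, hk, hka⟩ := ha
          exact ⟨k, hk, by rw [Subgroup.mem_subgroupOf]; simpa [show s = a from h] using hka⟩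
        · obtain ⟨k, hk, hkb⟩ := hb
          exact ⟨k, hk, by rw [Subgroup.mem_subgroupOf]; simpa [show s = b from h] using hkb⟩)
      (⟨a, haT⟩ * ⟨b, hbT⟩)
    exact ⟨k, hk, by simpa [Subgroup.mem_subgroupOf] using h⟩

theorem mem_isolator {G : Type u} [Group G] [Group.IsNilpotent G] {N : Subgroup G} {g : G} :
    g ∈ isolator N ↔ ∃ k : ℕ, 0 < k ∧ g ^ k ∈ N := Iff.rfl

/-! ### Roots in torsion-free nilpotent groups -/

/-- Successive quotients of the upper central series inherit torsion-freeness: modulo the `i`-th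
term `⁅x, g⁆` is central, so `⁅x, g⁆ ^ n` equals `⁅x ^ n, g⁆`, and induction applies to `⁅x, g⁆`. -/
theorem mem_upperCentralSeries_of_pow_mem_succ {G : Type u} [Group G]
    (htf : ∀ g : G, ∀ n : ℕ, 0 < n → g ^ n = 1 → g = 1) (i : ℕ) :
    ∀ (x : G) (n : ℕ), 0 < n → x ∈ Subgroup.upperCentralSeries G (i + 1) →
      x ^ n ∈ Subgroup.upperCentralSeries G i → x ∈ Subgroup.upperCentralSeries G i := by
  induction i with
  | zero =>
    intro x n hn _ h
    rw [Subgroup.upperCentralSeries_zero, Subgroup.mem_bot] at *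
    exact htf x n hn h
  | succ i ih =>
    intro x n hn hx h
    rw [Subgroup.mem_upperCentralSeries_succ_iff] at hx h ⊢
    intro g
    refine ih _ n hn (hx g) ?_
    have h1 := h g
    set Z := Subgroup.upperCentralSeries G i
    have hc : ⁅(QuotientGroup.mk' Z x), (QuotientGroup.mk' Z g)⁆ ∈ Subgroup.center (G ⧸ Z) := by
      rw [Subgroup.mem_center_iff]
      intro y
      obtain ⟨y, rfl⟩ := QuotientGroup.mk'_surjective Z y
      have h2 := (Subgroup.mem_upperCentralSeries_succ_iff.1 (hx g)) y
      have h3 : QuotientGroup.mk' Z ⁅⁅x, g⁆, y⁆ = 1 := (QuotientGroup.eq_one_iff _).2 h2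
      rw [map_commutatorElement, map_commutatorElement, commutatorElement_eq_one_iff_mul_comm] at h3
      exact h3.symm
    have h4 := commutatorElement_pow_left_of_central hc n
    have h5 : QuotientGroup.mk' Z ⁅x ^ n, g⁆ = 1 := (QuotientGroup.eq_one_iff _).2 h1
    rw [← (QuotientGroup.eq_one_iff (N := Z) _)]
    change QuotientGroup.mk' Z (⁅x, g⁆ ^ n) = 1
    rw [map_pow, map_commutatorElement, ← h4, ← map_pow, ← map_commutatorElement, h5]

theorem mem_center_of_pow_mem_center {G : Type u} [Group G] [Group.IsNilpotent G]
    (htf : ∀ g : G, ∀ n : ℕ, 0 < n → g ^ n = 1 → g = 1) {x : G} {n : ℕ} (hn : 0 < n)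
    (hx : x ^ n ∈ Subgroup.center G) : x ∈ Subgroup.center G := by
  rw [← Subgroup.upperCentralSeries_one] at *
  have key : ∀ j : ℕ, x ∈ Subgroup.upperCentralSeries G (1 + j) →
      x ∈ Subgroup.upperCentralSeries G 1 := by
    intro j
    induction j with
    | zero => exact fun h => h
    | succ j ih =>
      intro h
      exact ih (mem_upperCentralSeries_of_pow_mem_succ htf _ x n hn h
        (Subgroup.upperCentralSeries_mono G (by omega) hx))
  obtain ⟨c, hc⟩ := Group.IsNilpotent.nilpotent G
  refine key c (Subgroup.upperCentralSeries_mono G (show c ≤ 1 + c by omega) ?_)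
  rw [hc]; trivial

/-- Roots are unique in torsion-free nilpotent groups. -/
theorem pow_left_injective_of_torsionFree (G : Type u) [Group G] [Group.IsNilpotent G] :
    (∀ g : G, ∀ n : ℕ, 0 < n → g ^ n = 1 → g = 1) →
    ∀ (x y : G) (n : ℕ), 0 < n → x ^ n = y ^ n → x = y := by
  refine Group.nilpotent_center_quotient_ind
    (P := fun (G : Type u) _ _ => (∀ g : G, ∀ n : ℕ, 0 < n → g ^ n = 1 → g = 1) →
      ∀ (x y : G) (n : ℕ), 0 < n → x ^ n = y ^ n → x = y) G ?_ ?_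
  · intro G _ _ _ x y _ _ _
    exact Subsingleton.elim _ _
  · intro G _ _ ih htf x y n hn h
    have h1 := ih (by
      intro g n hn hg
      obtain ⟨g, rfl⟩ := QuotientGroup.mk'_surjective _ g
      rw [← map_pow] at hg
      exact (QuotientGroup.eq_one_iff _).2
        (mem_center_of_pow_mem_center htf hn ((QuotientGroup.eq_one_iff _).1 hg)))
      (QuotientGroup.mk' _ x) (QuotientGroup.mk' _ y) n hn (by rw [← map_pow, h, map_pow])
    have h2 : x⁻¹ * y ∈ Subgroup.center G := QuotientGroup.eq.1 h1
    -- With `x⁻¹ * y` central, `y ^ n = x ^ n * (x⁻¹ * y) ^ n`.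
    have h3 : (x⁻¹ * y) ^ n = 1 := by
      have hc : Commute x (x⁻¹ * y) := Subgroup.mem_center_iff.1 h2 x
      have := hc.mul_pow n
      rw [mul_inv_cancel_left, h] at this
      simpa using this
    exact inv_mul_eq_one.1 (htf _ n hn h3)

/-! ### Finitely generated nilpotent groups -/

theorem Subgroup.exists_finset_of_fg_map {G H : Type*} [Group G] [Group H] {f : G →* H}
    {K : Subgroup G} (h : (K.map f).FG) :
    ∃ s : Finset G, (s : Set G) ⊆ K ∧ ∀ x ∈ K, ∃ y ∈ Subgroup.closure (s : Set G), f x = f y := by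
  classical
  obtain ⟨S, hS⟩ := h
  have hsub : (S : Set H) ⊆ f '' K := by
    rw [← Subgroup.coe_map, ← hS]; exact Subgroup.subset_closure
  obtain ⟨s, hs, rfl⟩ := Finset.subset_set_image_iff.1 hsub
  refine ⟨s, hs, fun x hx => ?_⟩
  have hx' : f x ∈ K.map f := Subgroup.mem_map_of_mem f hx
  rw [← hS, Finset.coe_image, ← MonoidHom.map_closure] at hx'
  obtain ⟨y, hy, e⟩ := hx'
  exact ⟨y, hy, e.symm⟩

theorem Subgroup.fg_of_fg_map_of_fg_inf_ker {G H : Type*} [Group G] [Group H] (f : G →* H)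
    {K : Subgroup G} (h1 : (K.map f).FG) (h2 : (K ⊓ f.ker).FG) : K.FG := by
  obtain ⟨s, hs, h⟩ := Subgroup.exists_finset_of_fg_map h1
  have hsK : Subgroup.closure (s : Set G) ≤ K := (Subgroup.closure_le K).2 hs
  have e : K = Subgroup.closure (s : Set G) ⊔ (K ⊓ f.ker) := by
    refine le_antisymm (fun x hx => ?_) (sup_le hsK inf_le_left)
    obtain ⟨y, hy, e⟩ := h x hx
    have : x = y * (y⁻¹ * x) := by group
    rw [this]
    refine Subgroup.mul_mem_sup hy (Subgroup.mem_inf.2 ⟨mul_mem (inv_mem (hsK hy)) hx, ?_⟩)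
    rw [MonoidHom.mem_ker, map_mul, map_inv, e, inv_mul_cancel]
  rw [e]
  exact Subgroup.FG.sup ⟨s, rfl⟩ h2

theorem CommGroup.subgroup_fg {A : Type*} [CommGroup A] [Group.FG A] (L : Subgroup A) : L.FG := by
  rw [Subgroup.fg_iff_add_fg]
  have : Module.Finite ℤ (Additive A) := Module.Finite.iff_addGroup_fg.2 inferInstance
  have h := IsNoetherian.noetherian (AddSubgroup.toIntSubmodule (Subgroup.toAddSubgroup L))
  rw [Submodule.fg_iff_addSubgroup_fg] at h
  exact h

theorem Subgroup.fg_of_le_center {G : Type*} [Group G] {A L : Subgroup G} (hA : A.FG)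
    (hAc : A ≤ Subgroup.center G) (hL : L ≤ A) : L.FG := by
  let _ : CommGroup A := { (inferInstance : Group A) with
    mul_comm := fun a b => Subtype.ext (Subgroup.mem_center_iff.1 (hAc b.2) a) }
  have : Group.FG A := (Group.fg_iff_subgroup_fg A).2 hA
  have h := CommGroup.subgroup_fg (L.subgroupOf A)
  have e : (L.subgroupOf A).map A.subtype = L := by
    rw [Subgroup.subgroupOf_map_subtype, inf_eq_left.2 hL]
  rw [← e]
  obtain ⟨S, hS⟩ := h
  classical
  exact ⟨S.image A.subtype, by rw [Finset.coe_image, ← MonoidHom.map_closure, hS]⟩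

/-- The finitely many commutators of generators of the `m`-th term (modulo the next) with generators
of `G` suffice. They generate a central, hence normal, subgroup `C`; modulo `C` the `m`-th term is
central, so its commutators with `G` lie in `C`. -/
theorem lowerCentralSeries_fg_of_map_fg {G : Type u} [Group G] [Group.FG G] (m : ℕ)
    (hAc : (⊤ : Subgroup G).lowerCentralSeries (m + 1) ≤ Subgroup.center G)
    (h : (((⊤ : Subgroup G).lowerCentralSeries m).map
      (QuotientGroup.mk' ((⊤ : Subgroup G).lowerCentralSeries (m + 1)))).FG) :
    ((⊤ : Subgroup G).lowerCentralSeries (m + 1)).FG := by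
  classical
  obtain ⟨s, hs, hsg⟩ := Subgroup.exists_finset_of_fg_map h
  obtain ⟨X, hX⟩ := Group.fg_def.1 ‹Group.FG G›
  set A := (⊤ : Subgroup G).lowerCentralSeries (m + 1) with hA
  set T : Finset G := (s ×ˢ X).image (fun p => ⁅p.1, p.2⁆)
  set C := Subgroup.closure (T : Set G)
  have hCA : C ≤ A := by
    refine (Subgroup.closure_le A).2 ?_
    intro x hx
    obtain ⟨p, hp, rfl⟩ := Finset.mem_image.1 (Finset.mem_coe.1 hx)
    exact Subgroup.commutator_mem_commutator (hs (Finset.mem_product.1 hp).1) (Subgroup.mem_top _)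
  have : C.Normal := 
    ⟨fun c hc g => by
      rwa [Subgroup.mem_center_iff.1 (hAc (hCA hc)) g, mul_inv_cancel_right]⟩
  have hsZ : Subgroup.closure (s : Set G) ≤
      (Subgroup.center (G ⧸ C)).comap (QuotientGroup.mk' C) := by
    refine (Subgroup.closure_le _).2 fun a ha => ?_
    have h1 : Subgroup.closure (X : Set G) ≤
        (Subgroup.centralizer {QuotientGroup.mk' C a}).comap (QuotientGroup.mk' C) := by
      refine (Subgroup.closure_le _).2 fun x hx => ?_
      rw [SetLike.mem_coe, Subgroup.mem_comap, Subgroup.mem_centralizer_singleton_iff]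
      have h2 : QuotientGroup.mk' C ⁅a, x⁆ = 1 := (QuotientGroup.eq_one_iff _).2
        (Subgroup.subset_closure (Finset.mem_coe.2 (Finset.mem_image.2
          ⟨(a, x), Finset.mem_product.2 ⟨ha, hx⟩, rfl⟩)))
      rw [map_commutatorElement, commutatorElement_eq_one_iff_mul_comm] at h2
      exact h2.symm
    rw [SetLike.mem_coe, Subgroup.mem_comap, Subgroup.mem_center_iff]
    intro y
    obtain ⟨y, rfl⟩ := QuotientGroup.mk'_surjective C y
    have h3 : y ∈ Subgroup.closure (X : Set G) := by rw [hX]; trivial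
    exact Subgroup.mem_centralizer_singleton_iff.1 (h1 h3)
  have hmZ : (⊤ : Subgroup G).lowerCentralSeries m ≤
      (Subgroup.center (G ⧸ C)).comap (QuotientGroup.mk' C) := by
    intro p hp
    obtain ⟨y, hy, e⟩ := hsg p hp
    have h1 : y⁻¹ * p ∈ A := QuotientGroup.eq.1 e.symm
    have h2 : p = y * (y⁻¹ * p) := by group
    rw [h2]
    refine mul_mem (hsZ hy) ?_
    rw [Subgroup.mem_comap, Subgroup.mem_center_iff]
    intro q
    obtain ⟨q, rfl⟩ := QuotientGroup.mk'_surjective C q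
    rw [← map_mul, ← map_mul, Subgroup.mem_center_iff.1 (hAc h1) q]
  have hAC : A ≤ C := by
    rw [hA, Subgroup.lowerCentralSeries_succ, Subgroup.commutator_le]
    intro p hp q _
    refine (QuotientGroup.eq_one_iff (N := C) _).1 ?_
    change QuotientGroup.mk' C ⁅p, q⁆ = 1
    rw [map_commutatorElement, commutatorElement_eq_one_iff_mul_comm]
    exact (Subgroup.mem_center_iff.1 (hmZ hp) _).symm
  exact ⟨T, le_antisymm hCA hAC⟩

/-- A subgroup is an extension of its image modulo the last central term by a subgroup of that term,
a finitely generated abelian group. The first conjunct is kept for the finite-index argument. -/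
theorem subgroup_fg_of_nilpotent_aux (n : ℕ) : ∀ (G : Type u) [Group G] [Group.FG G],
    (⊤ : Subgroup G).lowerCentralSeries n = ⊥ →
    ((0 < n → ((⊤ : Subgroup G).lowerCentralSeries (n - 1)).FG) ∧ ∀ K : Subgroup G, K.FG) := by
  induction n with
  | zero =>
    intro G _ _ h
    refine ⟨fun h => absurd h (lt_irrefl 0), fun K => ?_⟩
    have : K = ⊥ := by
      rw [eq_bot_iff, ← h]; exact le_top
    rw [this]
    exact Subgroup.FG.bot
  | succ n ih =>
    intro G _ _ h
    have hAc := lowerCentralSeries_le_center h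
    obtain ⟨-, hQ⟩ := ih _ (lowerCentralSeries_quotient_eq_bot (G := G) n)
    have hA : ((⊤ : Subgroup G).lowerCentralSeries n).FG := by
      rcases n with _ | m
      · exact Group.fg_def.1 inferInstance
      · exact lowerCentralSeries_fg_of_map_fg m hAc (hQ _)
    refine ⟨fun _ => hA, fun K => ?_⟩
    refine Subgroup.fg_of_fg_map_of_fg_inf_ker
      (QuotientGroup.mk' ((⊤ : Subgroup G).lowerCentralSeries n)) (hQ _) ?_
    rw [QuotientGroup.ker_mk']
    exact Subgroup.fg_of_le_center hA hAc inf_le_right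

/-- Subgroups of finitely generated nilpotent groups are finitely generated. -/
theorem subgroup_fg_of_nilpotent {G : Type u} [Group G] [Group.FG G] [Group.IsNilpotent G]
    (K : Subgroup G) : K.FG := by
  obtain ⟨n, hn⟩ := Subgroup.nilpotent_iff_lowerCentralSeries.1 ‹Group.IsNilpotent G›
  exact (subgroup_fg_of_nilpotent_aux n G hn).2 K

theorem wellFoundedGT_subgroup_of_fg {G : Type u} [Group G] (h : ∀ K : Subgroup G, K.FG) :
    WellFoundedGT (Subgroup G) := by
  rw [wellFoundedGT_iff_monotone_chain_condition]
  intro a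
  obtain ⟨S, hS⟩ := h (⨆ i, a i)
  have hmem : ∀ x ∈ S, ∃ n, x ∈ a n := fun x hx =>
    (Subgroup.mem_iSup_of_directed a.monotone.directed_le).1 (hS ▸ Subgroup.subset_closure hx)
  choose! f hf using hmem
  refine ⟨S.sup f, fun m hm => le_antisymm (a.monotone hm) ?_⟩
  refine (le_iSup (fun i => a i) m).trans ?_
  rw [← hS, Subgroup.closure_le]
  exact fun x hx => a.monotone (Finset.le_sup hx) (hf x hx)

/-! ### Finite index from powers -/

theorem Subgroup.relIndex_sup_ne_zero {G : Type*} [Group G] {H A : Subgroup G} [A.Normal]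
    (h : H.relIndex A ≠ 0) : H.relIndex (H ⊔ A) ≠ 0 := by
  have hfin : Finite (A ⧸ H.subgroupOf A) := Nat.finite_of_card_ne_zero h
  have hle : A ≤ H ⊔ A := le_sup_right
  have : Function.Surjective (Subgroup.quotientSubgroupOfEmbeddingOfLE H hle) := by
    intro y
    obtain ⟨⟨y, hy⟩, rfl⟩ := QuotientGroup.mk_surjective y
    have hy' := hy
    rw [sup_comm, Subgroup.mem_sup_of_normal_left] at hy'
    obtain ⟨a, ha, b, hb, rfl⟩ := hy'
    refine ⟨QuotientGroup.mk ⟨a, ha⟩, QuotientGroup.eq.2 ?_⟩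
    rw [Subgroup.mem_subgroupOf]
    simpa using hb
  have : Finite (↥(H ⊔ A) ⧸ H.subgroupOf (H ⊔ A)) := Finite.of_surjective _ this
  exact Subgroup.index_ne_zero_of_finite (H := H.subgroupOf (H ⊔ A))

/-- Let `A` be the last central term. The index of `H ⊔ A` is finite by induction on `G ⧸ A`, and
that of `H` in `H ⊔ A` because `A / (A ∩ H)` is a finitely generated torsion abelian group. -/
theorem index_ne_zero_of_exists_pow_mem_aux (n : ℕ) : ∀ (G : Type u) [Group G] [Group.FG G],
    (⊤ : Subgroup G).lowerCentralSeries n = ⊥ → ∀ H : Subgroup G,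
    (∀ g : G, ∃ k : ℕ, 0 < k ∧ g ^ k ∈ H) → H.index ≠ 0 := by
  induction n with
  | zero =>
    intro G _ _ h H _
    have : H = ⊤ := by
      rw [eq_top_iff]
      exact (le_of_eq h).trans bot_le
    rw [this, Subgroup.index_top]
    exact one_ne_zero
  | succ n ih =>
    intro G _ _ h H hH
    have hA := (subgroup_fg_of_nilpotent_aux (n + 1) G h).1 n.succ_pos
    rw [Nat.add_sub_cancel] at hA
    have hAc := lowerCentralSeries_le_center h
    have hQ := ih _ (lowerCentralSeries_quotient_eq_bot (G := G) n)
      (H.map (QuotientGroup.mk' _)) (by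
        intro g
        obtain ⟨g, rfl⟩ := QuotientGroup.mk'_surjective _ g
        obtain ⟨k, hk, hg⟩ := hH g
        exact ⟨k, hk, by rw [← map_pow]; exact Subgroup.mem_map_of_mem _ hg⟩)
    set A := (⊤ : Subgroup G).lowerCentralSeries n
    rw [Subgroup.index_map, QuotientGroup.ker_mk'] at hQ
    rw [← Subgroup.relIndex_mul_index (le_sup_left : H ≤ H ⊔ A)]
    refine mul_ne_zero (Subgroup.relIndex_sup_ne_zero ?_) (left_ne_zero_of_mul hQ)
    let _ : CommGroup A := { (inferInstance : Group A) with
      mul_comm := fun a b => Subtype.ext (Subgroup.mem_center_iff.1 (hAc b.2) a) }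
    have : Group.FG A := (Group.fg_iff_subgroup_fg A).2 hA
    have : Finite (A ⧸ H.subgroupOf A) := by
      refine CommGroup.finite_of_fg_isMulTorsion _ ?_
      intro g
      obtain ⟨g, rfl⟩ := QuotientGroup.mk'_surjective _ g
      obtain ⟨k, hk, hg⟩ := hH g
      rw [isOfFinOrder_iff_pow_eq_one]
      refine ⟨k, hk, ?_⟩
      rw [← map_pow]
      exact (QuotientGroup.eq_one_iff _).2 (by rw [Subgroup.mem_subgroupOf]; simpa using hg)
    exact Subgroup.index_ne_zero_of_finite (H := H.subgroupOf A)

/-- A subgroup of a finitely generated nilpotent group containing a positive power of every element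
has finite index. -/
theorem finiteIndex_of_exists_pow_mem {G : Type u} [Group G] [Group.FG G] [Group.IsNilpotent G]
    (H : Subgroup G) (hH : ∀ g : G, ∃ k : ℕ, 0 < k ∧ g ^ k ∈ H) : H.FiniteIndex := by
  obtain ⟨n, hn⟩ := Subgroup.nilpotent_iff_lowerCentralSeries.1 ‹Group.IsNilpotent G›
  exact ⟨index_ne_zero_of_exists_pow_mem_aux n G hn H hH⟩

/-! ### The commensurator and the automorphisms of a rational Mal'cev completion -/

namespace IsRationalMalcevCompletion

variable {N : Type u} {M : Type v} [Group N] [Group M] {ι : N →* M}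

theorem eq_of_pow_eq (h : IsRationalMalcevCompletion ι) {k : ℕ} (hk : 0 < k) {x y : M}
    (e : x ^ k = y ^ k) : x = y :=
  (h.uniquelyDivisible k hk).1 e

theorem exists_pow_eq_of_finiteIndex (h : IsRationalMalcevCompletion ι) (K : Subgroup N)
    (hK : K.FiniteIndex) (m : M) : ∃ k : ℕ, 0 < k ∧ ∃ x ∈ K, ι x = m ^ k := by
  obtain ⟨k, hk, n, hn⟩ := h.exists_pow_mem m
  obtain ⟨l, hl, -, hnl⟩ := Subgroup.exists_pow_mem_of_index_ne_zero hK.index_ne_zero n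
  exact ⟨k * l, Nat.mul_pos hk hl, n ^ l, hnl, by rw [map_pow, hn, pow_mul]⟩

theorem exists_pow_mem_range_prod (h : IsRationalMalcevCompletion ι) {H : Type*} [Group H]
    (a b : H →* M) (ha : ∀ m : M, ∃ k : ℕ, 0 < k ∧ ∃ x, a x = m ^ k) (m : M) :
    ∃ m', ∃ k : ℕ, 0 < k ∧ ∃ x, a x = m ^ k ∧ b x = m' ^ k := by
  obtain ⟨k, hk, x, hx⟩ := ha m
  obtain ⟨m', hm'⟩ := (h.uniquelyDivisible k hk).2 (b x)
  exact ⟨m', k, hk, x, hx, hm'.symm⟩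

/-- Two embeddings of a group in the completion with cofinal images differ by an automorphism. -/
theorem exists_mulAut_of_injective (h : IsRationalMalcevCompletion ι) {H : Type*} [Group H]
    (a b : H →* M) (ha : ∀ m : M, ∃ k : ℕ, 0 < k ∧ ∃ x, a x = m ^ k)
    (hb : ∀ m : M, ∃ k : ℕ, 0 < k ∧ ∃ x, b x = m ^ k)
    (ha' : Function.Injective a) (hb' : Function.Injective b) :
    ∃ φ : MulAut M, ∀ x, φ (a x) = b x := by
  have := h.isNilpotent
  -- `R` is the graph of the desired automorphism; nilpotence of `M × M` makes it a subgroup, so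
  -- multiplicativity comes for free.
  set R : Subgroup (M × M) := isolator (a.prod b).range with hR
  have memR : ∀ p : M × M, p ∈ R ↔ ∃ k : ℕ, 0 < k ∧ ∃ x, a x = p.1 ^ k ∧ b x = p.2 ^ k := by
    intro p
    simp only [hR, mem_isolator, MonoidHom.mem_range, Prod.ext_iff, MonoidHom.prod_apply,
      Prod.pow_fst, Prod.pow_snd]
  let f : R →* M := (MonoidHom.fst M M).comp R.subtype
  let g : R →* M := (MonoidHom.snd M M).comp R.subtype
  have hf : Function.Bijective f := by
    constructor
    · rw [injective_iff_map_eq_one]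
      rintro ⟨⟨p, q⟩, hp⟩ (e : p = 1)
      subst e
      obtain ⟨k, hk, x, hx, hx'⟩ := (memR _).1 hp
      have : x = 1 := ha' (by simpa using hx)
      have : q = 1 := h.eq_of_pow_eq hk (by simpa [this] using hx'.symm)
      subst this
      rfl
    · intro m
      obtain ⟨m', hm'⟩ := h.exists_pow_mem_range_prod a b ha m
      exact ⟨⟨(m, m'), (memR _).2 hm'⟩, rfl⟩
  have hg : Function.Bijective g := by
    constructor
    · rw [injective_iff_map_eq_one]
      rintro ⟨⟨p, q⟩, hp⟩ (e : q = 1)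
      subst e
      obtain ⟨k, hk, x, hx, hx'⟩ := (memR _).1 hp
      have : x = 1 := hb' (by simpa using hx')
      have : p = 1 := h.eq_of_pow_eq hk (by simpa [this] using hx.symm)
      subst this
      rfl
    · intro m
      obtain ⟨m', k, hk, x, hx, hx'⟩ := h.exists_pow_mem_range_prod b a hb m
      exact ⟨⟨(m', m), (memR _).2 ⟨k, hk, x, hx', hx⟩⟩, rfl⟩
  refine ⟨(MulEquiv.ofBijective f hf).symm.trans (MulEquiv.ofBijective g hg), fun x => ?_⟩
  have hx : (a x, b x) ∈ R := (memR _).2 ⟨1, one_pos, x, by simp⟩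
  have e : (MulEquiv.ofBijective f hf).symm (a x) = ⟨(a x, b x), hx⟩ := by
    rw [MulEquiv.symm_apply_eq]; rfl
  rw [MulEquiv.trans_apply, e]
  rfl

/-- The restriction of an automorphism of the completion to a partial isomorphism. -/
noncomputable def restrict [Group.FG N] [Group.IsNilpotent N]
    (h : IsRationalMalcevCompletion ι) (φ : MulAut M) : PartialIso N where
  dom := ι.range.comap (φ.toMonoidHom.comp ι)
  cod := ι.range.comap (φ.symm.toMonoidHom.comp ι)
  finiteIndex_dom := finiteIndex_of_exists_pow_mem _ fun g => by
    obtain ⟨k, hk, hg⟩ := h.exists_pow_mem (φ (ι g))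
    exact ⟨k, hk, by simpa using hg⟩
  finiteIndex_cod := finiteIndex_of_exists_pow_mem _ fun g => by
    obtain ⟨k, hk, hg⟩ := h.exists_pow_mem (φ.symm (ι g))
    exact ⟨k, hk, by simpa using hg⟩
  toEquiv :=
    { toFun := fun x => ⟨x.2.choose, x, by
        have := x.2.choose_spec
        change ι x.2.choose = φ (ι x) at this
        change ι x = φ.symm (ι x.2.choose)
        rw [this, MulEquiv.symm_apply_apply]⟩
      invFun := fun y => ⟨y.2.choose, y, by
        have := y.2.choose_spec
        change ι y.2.choose = φ.symm (ι y) at this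
        change ι y = φ (ι y.2.choose)
        rw [this, MulEquiv.apply_symm_apply]⟩
      left_inv := fun x => by
        refine Subtype.ext (h.injective ?_)
        refine (Exists.choose_spec (p := fun y => ι y = φ.symm (ι x.2.choose)) _).trans ?_
        have := x.2.choose_spec
        change ι x.2.choose = φ (ι x) at this
        rw [this, MulEquiv.symm_apply_apply]
      right_inv := fun y => by
        refine Subtype.ext (h.injective ?_)
        refine (Exists.choose_spec (p := fun x => ι x = φ (ι y.2.choose)) _).trans ?_
        have := y.2.choose_spec
        change ι y.2.choose = φ.symm (ι y) at this
        rw [this, MulEquiv.apply_symm_apply]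
      map_mul' := fun x y => by
        refine Subtype.ext (h.injective ?_)
        have h1 := x.2.choose_spec
        have h2 := y.2.choose_spec
        have h3 := (x * y).2.choose_spec
        change ι x.2.choose = φ (ι x) at h1
        change ι y.2.choose = φ (ι y) at h2
        change ι (x * y).2.choose = φ (ι (x * y)) at h3
        change ι (x * y).2.choose = ι (x.2.choose * y.2.choose)
        rw [h3, map_mul, map_mul, map_mul, h1, h2] }

variable [Group.FG N] [Group.IsNilpotent N]

theorem map_restrict (h : IsRationalMalcevCompletion ι) (φ : MulAut M) (x : (h.restrict φ).dom) :
    ι ((h.restrict φ).toEquiv x) = φ (ι x) :=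
  x.2.choose_spec

/-- The homomorphism from the automorphism group of the completion to the commensurator. -/
noncomputable def toComm (h : IsRationalMalcevCompletion ι) : MulAut M →* Comm N :=
  MonoidHom.mk' (fun φ => (Quotient.mk _ (h.restrict φ) : Comm N)) fun φ ψ => by
    refine Quotient.sound ?_
    have key : ∀ x ∈ ((h.restrict φ).comp (h.restrict ψ)).dom, ∃ (a : x ∈ (h.restrict ψ).dom)
        (b : ((h.restrict ψ).toEquiv ⟨x, a⟩ : N) ∈ (h.restrict φ).dom),
        ι ((h.restrict φ).toEquiv ⟨_, b⟩) = φ (ψ (ι x)) := by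
      intro x hx
      obtain ⟨a, b⟩ := (PartialIso.mem_pull _ _ _).1 hx
      exact ⟨a, b, by rw [map_restrict, map_restrict]⟩
    -- The restriction of the product may have a larger domain than the composite, so the comparison
    -- is made on the latter.
    refine ⟨((h.restrict φ).comp (h.restrict ψ)).dom,
      ((h.restrict φ).comp (h.restrict ψ)).finiteIndex_dom, fun x hx => ?_, le_rfl,
      fun x hx => h.injective ?_⟩
    · obtain ⟨a, b, e⟩ := key x hx
      exact ⟨_, e⟩
    · obtain ⟨a, b, e⟩ := key x hx
      rw [map_restrict]
      exact e.symm

theorem toComm_injective (h : IsRationalMalcevCompletion ι) : Function.Injective h.toComm := by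
  intro φ ψ e
  obtain ⟨K, hK, h1, h2, e⟩ := Quotient.exact e
  refine MulEquiv.ext fun m => ?_
  obtain ⟨k, hk, x, hx, hm⟩ := h.exists_pow_eq_of_finiteIndex K hK m
  refine h.eq_of_pow_eq hk ?_
  have := congrArg ι (e x hx)
  rwa [map_restrict, map_restrict, hm, map_pow, map_pow] at this

/-- The inclusion of `α.dom` and the map `α` are two embeddings of one group into `M` whose images
contain a power of every element, so some automorphism carries one to the other. -/
theorem toComm_surjective (h : IsRationalMalcevCompletion ι) : Function.Surjective h.toComm := by
  rintro ⟨α⟩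
  obtain ⟨φ, hφ⟩ := h.exists_mulAut_of_injective (ι.comp α.dom.subtype)
    ((ι.comp α.cod.subtype).comp α.toEquiv.toMonoidHom)
    (fun m => by
      obtain ⟨k, hk, x, hx, e⟩ := h.exists_pow_eq_of_finiteIndex _ α.finiteIndex_dom m
      exact ⟨k, hk, ⟨x, hx⟩, e⟩)
    (fun m => by
      obtain ⟨k, hk, x, hx, e⟩ := h.exists_pow_eq_of_finiteIndex _ α.finiteIndex_cod m
      exact ⟨k, hk, α.toEquiv.symm ⟨x, hx⟩, by simpa using e⟩)
    (h.injective.comp Subtype.val_injective)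
    ((h.injective.comp Subtype.val_injective).comp α.toEquiv.injective)
  refine ⟨φ, Quotient.sound ?_⟩
  have hle : α.dom ≤ (h.restrict φ).dom := fun x hx => ⟨_, (hφ ⟨x, hx⟩).symm⟩
  refine ⟨α.dom, α.finiteIndex_dom, hle, le_rfl, fun x hx => h.injective ?_⟩
  rw [map_restrict]
  exact hφ ⟨x, hx⟩

/-- The commensurator is isomorphic to the automorphism group of the completion. -/
noncomputable def commEquivMulAut (h : IsRationalMalcevCompletion ι) : Comm N ≃* MulAut M :=
  (MulEquiv.ofBijective h.toComm ⟨h.toComm_injective, h.toComm_surjective⟩).symm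

end IsRationalMalcevCompletion

/-! ### The unipotent filtration of a representation -/

section UnipotentFiltration

variable {G V : Type*} [Group G] [AddCommGroup V] [Module ℚ V]

/-- The upper unipotent filtration of a representation: `v` lies in the term `d + 1` if
`g v - v` lies in the term `d` for all `g`. -/
def unipotentFiltration (ρ : G →* Module.End ℚ V) : ℕ → Submodule ℚ V
  | 0 => ⊥
  | d + 1 => ⨅ g : G, (unipotentFiltration ρ d).comap (ρ g - 1)

variable {ρ : G →* Module.End ℚ V}

theorem mem_unipotentFiltration_zero {v : V} : v ∈ unipotentFiltration ρ 0 ↔ v = 0 :=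
  Submodule.mem_bot ℚ

theorem mem_unipotentFiltration_succ {d : ℕ} {v : V} :
    v ∈ unipotentFiltration ρ (d + 1) ↔ ∀ g, ρ g v - v ∈ unipotentFiltration ρ d := by
  simp [unipotentFiltration]

theorem unipotentFiltration_mono : Monotone (unipotentFiltration ρ) := by
  refine monotone_nat_of_le_succ fun d => ?_
  induction d with
  | zero => exact bot_le
  | succ d ih =>
    intro v hv
    rw [mem_unipotentFiltration_succ] at hv ⊢
    exact fun g => ih (hv g)

/-- The identity `(g - 1) h = h (h⁻¹ g h - 1)` makes both filtrations below invariant under the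
group. -/
theorem map_conj_sub (g h : G) (v : V) :
    ρ g (ρ h v) - ρ h v = ρ h (ρ (h⁻¹ * g * h) v - v) := by
  rw [map_sub, ← Module.End.mul_apply, ← Module.End.mul_apply, ← map_mul, ← map_mul]
  congr 3
  group

theorem map_mem_unipotentFiltration {d : ℕ} {v : V} (hv : v ∈ unipotentFiltration ρ d) (h : G) :
    ρ h v ∈ unipotentFiltration ρ d := by
  induction d generalizing v with
  | zero => rw [mem_unipotentFiltration_zero] at *; rw [hv, map_zero]
  | succ d ih =>
    rw [mem_unipotentFiltration_succ] at hv ⊢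
    intro g
    rw [map_conj_sub]
    exact ih (hv _)

/-- The elements of a group moving a vector by a vector in an invariant subspace. -/
def Submodule.moveSubgroup (ρ : G →* Module.End ℚ V) (W : Submodule ℚ V)
    (hW : ∀ g, ∀ w ∈ W, ρ g w ∈ W) (v : V) : Subgroup G where
  carrier := {g | ρ g v - v ∈ W}
  one_mem' := by simp
  mul_mem' := by
    intro a b ha hb
    have : ρ (a * b) v - v = ρ a (ρ b v - v) + (ρ a v - v) := by
      rw [map_mul, Module.End.mul_apply, map_sub]; abel
    rw [Set.mem_ofPred_eq, this]
    exact add_mem (hW a _ hb) ha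
  inv_mem' := by
    intro a ha
    have : ρ a⁻¹ v - v = - ρ a⁻¹ (ρ a v - v) := by
      rw [map_sub, ← Module.End.mul_apply, ← map_mul]; simp
    rw [Set.mem_ofPred_eq, this]
    exact neg_mem (hW _ _ ha)

theorem mem_unipotentFiltration_map {G' V' : Type*} [Group G'] [AddCommGroup V'] [Module ℚ V']
    {σ : G' →* Module.End ℚ V'} (ψ : G' →* G) (φ : V →ₗ[ℚ] V')
    (h : ∀ g v, φ (ρ (ψ g) v) = σ g (φ v)) {d : ℕ} {v : V} (hv : v ∈ unipotentFiltration ρ d) :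
    φ v ∈ unipotentFiltration σ d := by
  induction d generalizing v with
  | zero => rw [mem_unipotentFiltration_zero] at *; rw [hv, map_zero]
  | succ d ih =>
    rw [mem_unipotentFiltration_succ] at hv ⊢
    intro g
    rw [← h, ← map_sub]
    exact ih (hv _)

/-- The unipotent filtration of the restriction to `H`, weighted by the lower central series of the
whole group. -/
def weightedFiltration (ρ : G →* Module.End ℚ V) (H : Subgroup G) : ℕ → Submodule ℚ V
  | 0 => ⊥
  -- The series starts at `i = 0` with the whole group, so an element of the `i`-th term lowers the
  -- weight by `i + 1`. Truncated subtraction sends `i ≥ d` to the zero term.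
  | d + 1 => ⨅ i : ℕ, ⨅ g : ↥(H ⊓ (⊤ : Subgroup G).lowerCentralSeries i),
      (weightedFiltration ρ H (d - i)).comap (ρ g - 1)
  termination_by d => d
  decreasing_by omega

variable {H : Subgroup G}

theorem mem_weightedFiltration_zero {v : V} : v ∈ weightedFiltration ρ H 0 ↔ v = 0 := by
  rw [weightedFiltration, Submodule.mem_bot]

theorem mem_weightedFiltration_succ {d : ℕ} {v : V} :
    v ∈ weightedFiltration ρ H (d + 1) ↔ ∀ i, ∀ g ∈ H, g ∈ (⊤ : Subgroup G).lowerCentralSeries i →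
      ρ g v - v ∈ weightedFiltration ρ H (d - i) := by
  rw [weightedFiltration]
  simp only [Submodule.mem_iInf, Submodule.mem_comap, LinearMap.sub_apply, Module.End.one_apply,
    Subtype.forall, Subgroup.mem_inf, and_imp]

theorem weightedFiltration_mono : Monotone (weightedFiltration ρ H) := by
  refine monotone_nat_of_le_succ fun d => ?_
  induction d using Nat.strong_induction_on with
  | _ d ih =>
    intro v hv
    rcases d with _ | d
    · rw [mem_weightedFiltration_zero] at hv
      rw [hv]; exact zero_mem _
    · rw [mem_weightedFiltration_succ] at hv ⊢
      intro i g hg hgi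
      by_cases hi : i ≤ d
      · rw [Nat.sub_add_comm hi]
        exact ih _ (by omega) (hv i g hg hgi)
      · have := hv i g hg hgi
        rwa [show d - i = d + 1 - i by omega] at this

theorem map_mem_weightedFiltration [H.Normal] {d : ℕ} {v : V} (hv : v ∈ weightedFiltration ρ H d)
    (h : G) : ρ h v ∈ weightedFiltration ρ H d := by
  induction d using Nat.strong_induction_on generalizing v with
  | _ d ih =>
    rcases d with _ | d
    · rw [mem_weightedFiltration_zero] at *; rw [hv, map_zero]
    · rw [mem_weightedFiltration_succ] at hv ⊢
      intro i g hg hgi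
      rw [map_conj_sub]
      refine ih _ (by omega) (hv i _ ?_ ?_)
      · simpa using Subgroup.Normal.conj_mem ‹H.Normal› g hg h⁻¹
      · simpa using Subgroup.Normal.conj_mem
          (inferInstance : ((⊤ : Subgroup G).lowerCentralSeries i).Normal) g hgi h⁻¹

/-- Nontrivial elements occur only in terms with `i < c`, so weight `c + 1` per degree covers every
drop. -/
theorem unipotentFiltration_le_weightedFiltration {c : ℕ}
    (hc : (⊤ : Subgroup G).lowerCentralSeries c = ⊥) (d : ℕ) :
    unipotentFiltration (ρ.comp H.subtype) d ≤ weightedFiltration ρ H ((c + 1) * d) := by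
  induction d with
  | zero => exact bot_le
  | succ d ih =>
    intro v hv
    rw [mem_unipotentFiltration_succ] at hv
    rw [show (c + 1) * (d + 1) = ((c + 1) * d + c) + 1 by ring, mem_weightedFiltration_succ]
    intro i g hg hgi
    by_cases hi : i ≤ c
    · exact weightedFiltration_mono (by omega) (ih (hv ⟨g, hg⟩))
    · have h1 : g ∈ (⊤ : Subgroup G).lowerCentralSeries c :=
        Subgroup.lowerCentralSeries_antitone _ (by omega) hgi
      rw [hc, Subgroup.mem_bot] at h1
      simp [h1]

/-- Commuting `t - 1` past `g - 1` costs a commutator of `g` with `t`, which lies one step deeper in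
the lower central series. The weights are designed so that this extra depth pays for the degree that
`t - 1` must lower. -/
theorem map_sub_mem_weightedFiltration [H.Normal] {t : G}
    (ht : ∀ v : V, (∀ g ∈ H, ρ g v = v) → ρ t v = v) {d : ℕ} {v : V}
    (hv : v ∈ weightedFiltration ρ H (d + 1)) : ρ t v - v ∈ weightedFiltration ρ H d := by
  induction d using Nat.strong_induction_on generalizing v with
  | _ d ih =>
    rw [mem_weightedFiltration_succ] at hv
    rcases d with _ | e
    · rw [mem_weightedFiltration_zero, sub_eq_zero]
      refine ht v fun g hg => ?_
      have := hv 0 g hg (Subgroup.mem_top g)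
      rwa [mem_weightedFiltration_zero, sub_eq_zero] at this
    · rw [mem_weightedFiltration_succ]
      intro i g hg hgi
      set c := g⁻¹ * t⁻¹ * g * t with hc
      have hcH : c ∈ H := by
        rw [hc, mul_assoc, mul_assoc]
        refine mul_mem (inv_mem hg) ?_
        simpa [mul_assoc] using Subgroup.Normal.conj_mem ‹H.Normal› g hg t⁻¹
      have hci : c ∈ (⊤ : Subgroup G).lowerCentralSeries (i + 1) := by
        have := Subgroup.commutator_mem_commutator (inv_mem hgi) (Subgroup.mem_top t⁻¹)
        rwa [commutatorElement_def, inv_inv, inv_inv] at this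
      -- From `g t = t g c`: `(g - 1)(t - 1) = (t - 1)(g - 1) + t g (c - 1)`.
      have key : ρ g (ρ t v - v) - (ρ t v - v) =
          (ρ t (ρ g v - v) - (ρ g v - v)) + ρ (t * g) (ρ c v - v) := by
        have h1 : ρ g (ρ t v) = ρ (t * g) (ρ c v) := by
          rw [← Module.End.mul_apply, ← Module.End.mul_apply, ← map_mul, ← map_mul, hc]
          congr 2
          group
        rw [map_sub, h1, map_sub, map_sub, map_mul, Module.End.mul_apply, Module.End.mul_apply]
        abel
      rw [key]
      refine add_mem ?_ (map_mem_weightedFiltration ?_ _)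
      · have h1 := hv i g hg hgi
        by_cases hi : i ≤ e
        · rw [Nat.sub_add_comm hi] at h1
          exact ih _ (by omega) h1
        · rw [show e + 1 - i = 0 by omega, mem_weightedFiltration_zero] at h1
          rw [h1]
          simp
      · have := hv (i + 1) c hcH hci
        rwa [Nat.add_sub_add_right] at this

theorem weightedFiltration_le_unipotentFiltration [H.Normal] {t : G}
    (ht : ∀ v : V, (∀ g ∈ H, ρ g v = v) → ρ t v = v) (htop : H ⊔ Subgroup.zpowers t = ⊤) (d : ℕ) :
    weightedFiltration ρ H d ≤ unipotentFiltration ρ d := by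
  induction d with
  | zero => rw [weightedFiltration]; exact bot_le
  | succ d ih =>
    intro v hv
    have h1 := map_sub_mem_weightedFiltration ht hv
    rw [mem_weightedFiltration_succ] at hv
    rw [mem_unipotentFiltration_succ]
    have h2 : H ⊔ Subgroup.zpowers t ≤ Submodule.moveSubgroup ρ (unipotentFiltration ρ d)
        (fun g w hw => map_mem_unipotentFiltration hw g) v := by
      refine sup_le (fun g hg => ih (hv 0 g hg (Subgroup.mem_top g))) ?_
      rw [Subgroup.zpowers_le]
      exact ih h1
    rw [htop] at h2
    exact fun g => h2 (Subgroup.mem_top g)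

end UnipotentFiltration

/-! ### Polynomial functions on nilpotent groups -/

/-- The permutation representation on rational functions. -/
def functionRep (G X : Type*) [Group G] [MulAction G X] : G →* Module.End ℚ (X → ℚ) where
  toFun g := LinearMap.funLeft ℚ ℚ (fun x => g⁻¹ • x)
  map_one' := by ext f x; simp [LinearMap.funLeft_apply]
  map_mul' g h := by ext f x; simp [LinearMap.funLeft_apply, mul_smul]

theorem functionRep_apply {G X : Type*} [Group G] [MulAction G X] (g : G) (f : X → ℚ) (x : X) :
    functionRep G X g f x = f (g⁻¹ • x) := rfl

/-- The rational polynomial functions of bounded degree on `G` separate points from `1`. -/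
def PolynomialsSeparate (G : Type*) [Group G] : Prop :=
  ∃ d : ℕ, ∀ x : G, x ≠ 1 → ∃ f ∈ unipotentFiltration (functionRep G G) d, f x ≠ f 1

theorem PolynomialsSeparate.of_mulEquiv {G G' : Type*} [Group G] [Group G'] (e : G ≃* G')
    (h : PolynomialsSeparate G') : PolynomialsSeparate G := by
  obtain ⟨d, hd⟩ := h
  refine ⟨d, fun x hx => ?_⟩
  obtain ⟨f, hf, hfx⟩ := hd (e x) (by simpa using hx)
  refine ⟨LinearMap.funLeft ℚ ℚ e f, mem_unipotentFiltration_map e.toMonoidHom _ ?_ hf, ?_⟩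
  · intro g f
    ext y
    simp [functionRep_apply, LinearMap.funLeft_apply]
  · simpa [LinearMap.funLeft_apply] using hfx

theorem polynomialsSeparate_of_subsingleton (G : Type*) [Group G] [Subsingleton G] :
    PolynomialsSeparate G :=
  ⟨0, fun _ hx => absurd (Subsingleton.elim _ _) hx⟩

theorem const_mem_unipotentFiltration {G X : Type*} [Group G] [MulAction G X] (a : ℚ) :
    (fun _ => a) ∈ unipotentFiltration (functionRep G X) 1 := by
  rw [mem_unipotentFiltration_succ]
  intro g
  rw [mem_unipotentFiltration_zero]
  ext x
  simp [functionRep_apply]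

/-- The index is degree plus one: constants lie in term `1`, additive characters in term `2`. -/
theorem hom_mem_unipotentFiltration {G : Type*} [Group G] (χ : G → ℚ)
    (hχ : ∀ x y, χ (x * y) = χ x + χ y) : χ ∈ unipotentFiltration (functionRep G G) 2 := by
  rw [mem_unipotentFiltration_succ]
  intro g
  have : functionRep G G g χ - χ = fun _ => χ g⁻¹ := by
    ext x
    simp [functionRep_apply, hχ]
  rw [this]
  exact const_mem_unipotentFiltration _

section InfiniteCyclicExtension

variable {G : Type*} [Group G] {H : Subgroup G} [H.Normal] {t : G}

theorem exists_zpow_of_sup_eq_top (htop : H ⊔ Subgroup.zpowers t = ⊤) (x : G) :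
    ∃ n : ℤ, ∃ h ∈ H, x = h * t ^ n := by
  have hx : x ∈ H ⊔ Subgroup.zpowers t := by rw [htop]; trivial
  rw [Subgroup.mem_sup_of_normal_left] at hx
  obtain ⟨h, hh, y, hy, rfl⟩ := hx
  obtain ⟨n, rfl⟩ := Subgroup.mem_zpowers_iff.1 hy
  exact ⟨n, h, hh, rfl⟩

theorem exists_hom_of_infinite_cyclic_quotient (htop : H ⊔ Subgroup.zpowers t = ⊤)
    (ht : ∀ n : ℤ, t ^ n ∈ H → n = 0) :
    ∃ χ : G → ℚ, (∀ x y, χ (x * y) = χ x + χ y) ∧ ∀ n : ℤ, χ (t ^ n) = n := by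
  choose χ h hh e using exists_zpow_of_sup_eq_top htop
  have uniq : ∀ (n m : ℤ) (a b : G), a ∈ H → b ∈ H → a * t ^ n = b * t ^ m → n = m := by
    intro n m a b ha hb hab
    refine sub_eq_zero.1 (ht _ ?_)
    have : t ^ (n - m) = a⁻¹ * b := by
      rw [zpow_sub, eq_inv_mul_iff_mul_eq, ← mul_assoc, hab, mul_inv_cancel_right]
    rw [this]
    exact mul_mem (inv_mem ha) hb
  refine ⟨fun x => χ x, fun x y => ?_, fun n => ?_⟩
  · rw [← Int.cast_add, Int.cast_inj]
    refine uniq _ _ (h (x * y)) (h x * (t ^ χ x * h y * (t ^ χ x)⁻¹)) (hh _)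
      (mul_mem (hh _) (Subgroup.Normal.conj_mem ‹H.Normal› _ (hh y) _)) ?_
    rw [← e, zpow_add]
    conv_lhs => rw [e x, e y]
    group
  · rw [Int.cast_inj]
    exact uniq _ _ (h (t ^ n)) 1 (hh _) (one_mem _) (by rw [← e, one_mul])

/-- This transports functions on `H` to functions on `G ⧸ ⟨t⟩`, on which all of `G` acts. -/
theorem bijective_mk_zpowers (htop : H ⊔ Subgroup.zpowers t = ⊤)
    (ht : ∀ n : ℤ, t ^ n ∈ H → n = 0) :
    Function.Bijective (fun h : H => (QuotientGroup.mk (h : G) : G ⧸ Subgroup.zpowers t)) := by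
  constructor
  · intro a b hab
    obtain ⟨n, hn⟩ := Subgroup.mem_zpowers_iff.1 (QuotientGroup.eq.1 hab)
    have h1 : n = 0 := ht n (by rw [hn]; exact mul_mem (inv_mem a.2) b.2)
    rw [h1, zpow_zero] at hn
    exact Subtype.ext (inv_mul_eq_one.1 hn.symm)
  · intro y
    obtain ⟨x, rfl⟩ := QuotientGroup.mk_surjective y
    obtain ⟨n, h, hh, rfl⟩ := exists_zpow_of_sup_eq_top htop x
    refine ⟨⟨h, hh⟩, QuotientGroup.eq.2 ?_⟩
    simp

/-- A nontrivial power of `t` is detected by the character `G → ℤ` with kernel `H`. Any other `x` is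
nontrivial in `G ⧸ ⟨t⟩ ≃ H`, where a polynomial on `H` detects it; the weighted filtration shows
that this function is still polynomial for `G`. -/
theorem PolynomialsSeparate.of_infinite_cyclic_extension [Group.IsNilpotent G]
    (htop : H ⊔ Subgroup.zpowers t = ⊤) (ht : ∀ n : ℤ, t ^ n ∈ H → n = 0)
    (hH : PolynomialsSeparate H) : PolynomialsSeparate G := by
  obtain ⟨c, hc⟩ := Subgroup.nilpotent_iff_lowerCentralSeries.1 ‹Group.IsNilpotent G›
  obtain ⟨d, hd⟩ := hH
  refine ⟨max ((c + 1) * d) 2, fun x hx => ?_⟩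
  by_cases hxt : x ∈ Subgroup.zpowers t
  · obtain ⟨χ, hχ, hχt⟩ := exists_hom_of_infinite_cyclic_quotient htop ht
    obtain ⟨n, rfl⟩ := Subgroup.mem_zpowers_iff.1 hxt
    refine ⟨χ, unipotentFiltration_mono (le_max_right _ _) (hom_mem_unipotentFiltration χ hχ), ?_⟩
    rw [← zpow_zero t, hχt, hχt, Int.cast_zero, Int.cast_ne_zero]
    rintro rfl
    exact hx (zpow_zero t)
  · let e := Equiv.ofBijective _ (bijective_mk_zpowers htop ht)
    have he : ∀ (g : H) (y : G ⧸ Subgroup.zpowers t), e.symm ((g : G) • y) = g * e.symm y := by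
      intro g y
      rw [Equiv.symm_apply_eq]
      obtain ⟨b, rfl⟩ := e.surjective y
      rw [Equiv.symm_apply_apply]
      rfl
    have he1 : e.symm (QuotientGroup.mk (1 : G)) = 1 := by
      rw [Equiv.symm_apply_eq]; rfl
    have hex : e.symm (QuotientGroup.mk x) ≠ 1 := by
      rw [← he1, Ne, e.symm.injective.eq_iff, QuotientGroup.eq]
      simpa using hxt
    obtain ⟨f, hf, hfx⟩ := hd _ hex
    set F : G ⧸ Subgroup.zpowers t → ℚ := LinearMap.funLeft ℚ ℚ e.symm f with hF
    have hF1 : F ∈ unipotentFiltration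
        ((functionRep G (G ⧸ Subgroup.zpowers t)).comp H.subtype) d := by
      refine mem_unipotentFiltration_map (MonoidHom.id H) _ ?_ hf
      intro g v
      ext y
      change v (g⁻¹ • e.symm y) = v (e.symm ((g : G)⁻¹ • y))
      rw [← Subgroup.coe_inv, he]
      rfl
    have hF2 : F ∈ unipotentFiltration (functionRep G (G ⧸ Subgroup.zpowers t)) ((c + 1) * d) := by
      refine weightedFiltration_le_unipotentFiltration (t := t) ?_ htop _
        (unipotentFiltration_le_weightedFiltration hc d hF1)
      -- `H` is transitive on the cosets, so functions fixed by `H` are constant and hence fixed by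
      -- `t`.
      intro v hv
      have hconst : ∀ y, v y = v (QuotientGroup.mk 1) := by
        intro y
        obtain ⟨b, rfl⟩ := e.surjective y
        have h1 := congrFun (hv b b.2) (e b)
        rw [functionRep_apply] at h1
        rw [← h1]
        congr 1
        change (QuotientGroup.mk ((b : G)⁻¹ * b) : G ⧸ Subgroup.zpowers t) = _
        rw [inv_mul_cancel]
      ext y
      rw [functionRep_apply, hconst, hconst y]
    refine ⟨LinearMap.funLeft ℚ ℚ (fun x : G => (QuotientGroup.mk x : G ⧸ Subgroup.zpowers t)) F,
      unipotentFiltration_mono (le_max_left _ _)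
        (mem_unipotentFiltration_map (MonoidHom.id G) _ ?_ hF2), ?_⟩
    · intro g v
      rfl
    · change f (e.symm (QuotientGroup.mk x)) ≠ f (e.symm (QuotientGroup.mk 1))
      rwa [he1]

end InfiniteCyclicExtension

/-! ### Torsion-free nilpotent groups are poly-infinite-cyclic -/

/-- Torsion-freeness lets the exponents be divided by their gcd; Bézout coefficients `x`, `y` then
give the common root `t ^ x * g ^ y`. -/
theorem exists_zpow_eq_of_zpow_eq {A : Type*} [CommGroup A]
    (htf : ∀ g : A, ∀ n : ℕ, 0 < n → g ^ n = 1 → g = 1) {t g : A} {a : ℤ} {n : ℕ} (hn : 0 < n)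
    (h : g ^ n = t ^ a) : ∃ (u : A) (p q : ℤ), t = u ^ p ∧ g = u ^ q := by
  have hd : 0 < Int.gcd a n := Int.gcd_pos_of_ne_zero_right _ (by exact_mod_cast hn.ne')
  obtain ⟨a', n', hcop, ha, hn'⟩ := Int.exists_gcd_one hd
  have e : t ^ a' = g ^ n' := by
    refine inv_mul_eq_one.1 (htf _ _ hd ?_)
    rw [mul_pow, inv_pow, inv_mul_eq_one, ← zpow_natCast, ← zpow_natCast, ← zpow_mul, ← zpow_mul,
      ← ha, ← hn', zpow_natCast, h]
  obtain ⟨y, x, hxy⟩ := Int.isCoprime_iff_gcd_eq_one.2 hcop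
  refine ⟨t ^ x * g ^ y, n', a', ?_, ?_⟩
  · rw [mul_zpow, ← zpow_mul, ← zpow_mul, mul_comm y n', zpow_mul g, ← e, ← zpow_mul, ← zpow_add,
      mul_comm a' y, add_comm, hxy, zpow_one]
  · rw [mul_zpow, ← zpow_mul, ← zpow_mul, mul_comm x a', zpow_mul t, e, ← zpow_mul, ← zpow_add,
      mul_comm n' x, add_comm, hxy, zpow_one]

/-- Choose `t` central modulo `H` with `H⟨t⟩` maximal. If `g ^ n ∈ H⟨t⟩`, then `g` is also central
modulo `H` and shares a root `w` with `t` there; maximality forces `H⟨w⟩ = H⟨t⟩`, which contains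
`g`. -/
theorem exists_infinite_cyclic_extension {G : Type u} [Group G] [Group.IsNilpotent G]
    [WellFoundedGT (Subgroup G)] (H : Subgroup G) [H.Normal]
    (hH : ∀ g : G, ∀ n : ℕ, 0 < n → g ^ n ∈ H → g ∈ H) (hne : H ≠ ⊤) :
    ∃ t : G, t ∉ H ∧ (H ⊔ Subgroup.zpowers t).Normal ∧
      ∀ g : G, ∀ n : ℕ, 0 < n → g ^ n ∈ H ⊔ Subgroup.zpowers t → g ∈ H ⊔ Subgroup.zpowers t := by
  have htf : ∀ g : G ⧸ H, ∀ n : ℕ, 0 < n → g ^ n = 1 → g = 1 := by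
    intro g n hn hg
    obtain ⟨g, rfl⟩ := QuotientGroup.mk'_surjective _ g
    rw [← map_pow] at hg
    exact (QuotientGroup.eq_one_iff _).2 (hH g n hn ((QuotientGroup.eq_one_iff _).1 hg))
  have hnt : Nontrivial (G ⧸ H) := QuotientGroup.nontrivial_iff.2 hne
  let 𝒮 : Set (Subgroup G) := {L | ∃ z : G, z ∉ H ∧ QuotientGroup.mk' H z ∈
    Subgroup.center (G ⧸ H) ∧ L = H ⊔ Subgroup.zpowers z}
  have h𝒮 : 𝒮.Nonempty := by
    obtain ⟨⟨z, hz⟩, hz1⟩ := Subgroup.ne_bot_iff_exists_ne_one.1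
      (Group.IsNilpotent.center_ne_bot (G := G ⧸ H))
    obtain ⟨y, hy⟩ := QuotientGroup.mk'_surjective H z
    refine ⟨_, y, fun h => hz1 (Subtype.ext ?_), hy ▸ hz, rfl⟩
    exact hy.symm.trans ((QuotientGroup.eq_one_iff _).2 h)
  obtain ⟨L, ⟨t, htH, htc, rfl⟩, hmax⟩ := WellFounded.has_min
    (wellFounded_gt : WellFounded ((· > ·) : Subgroup G → Subgroup G → Prop)) 𝒮 h𝒮
  have hcomap : ∀ z : G, H ⊔ Subgroup.zpowers z =
      (Subgroup.zpowers (QuotientGroup.mk' H z)).comap (QuotientGroup.mk' H) := by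
    intro z
    rw [← MonoidHom.map_zpowers, Subgroup.comap_map_eq, QuotientGroup.ker_mk', sup_comm]
  refine ⟨t, htH, ?_, fun g n hn hg => ?_⟩
  · have : (Subgroup.zpowers (QuotientGroup.mk' H t)).Normal := by
      refine ⟨fun c hc g => ?_⟩
      have hc' := (Subgroup.zpowers_le.2 htc) hc
      rwa [Subgroup.mem_center_iff.1 hc' g, mul_inv_cancel_right]
    rw [hcomap]
    infer_instance
  · rw [hcomap, Subgroup.mem_comap, map_pow] at hg
    obtain ⟨a, ha⟩ := Subgroup.mem_zpowers_iff.1 hg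
    have hgc : QuotientGroup.mk' H g ∈ Subgroup.center (G ⧸ H) :=
      mem_center_of_pow_mem_center htf hn (ha ▸ zpow_mem htc a)
    let _ : CommGroup (Subgroup.center (G ⧸ H)) :=
      { (inferInstance : Group (Subgroup.center (G ⧸ H))) with
        mul_comm := fun a b => Subtype.ext (Subgroup.mem_center_iff.1 b.2 a) }
    obtain ⟨⟨w, hw⟩, p, q, h1, h2⟩ := exists_zpow_eq_of_zpow_eq
      (A := Subgroup.center (G ⧸ H)) (t := ⟨_, htc⟩) (g := ⟨_, hgc⟩)
      (fun x m hm hx => Subtype.ext (htf x m hm (congrArg Subtype.val hx)))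
      hn (Subtype.ext ha.symm)
    obtain ⟨w, rfl⟩ := QuotientGroup.mk'_surjective H w
    have h1 : QuotientGroup.mk' H t = QuotientGroup.mk' H w ^ p := by
      exact congrArg Subtype.val h1
    have h2 : QuotientGroup.mk' H g = QuotientGroup.mk' H w ^ q := by
      exact congrArg Subtype.val h2
    have hle : H ⊔ Subgroup.zpowers t ≤ H ⊔ Subgroup.zpowers w := by
      rw [hcomap, hcomap]
      refine Subgroup.comap_mono ?_
      rw [Subgroup.zpowers_le, h1]
      exact Subgroup.zpow_mem_zpowers _ _
    have hwH : w ∉ H := by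
      intro h
      refine htH ((QuotientGroup.eq_one_iff (N := H) t).1 (h1.trans ?_))
      rw [show QuotientGroup.mk' H w = 1 from (QuotientGroup.eq_one_iff w).2 h, one_zpow]
    have heq : H ⊔ Subgroup.zpowers t = H ⊔ Subgroup.zpowers w := by
      by_contra hlt
      exact hmax _ ⟨w, hwH, hw, rfl⟩ (lt_of_le_of_ne hle hlt)
    rw [heq, hcomap, Subgroup.mem_comap, h2]
    exact Subgroup.zpow_mem_zpowers _ _

theorem Subgroup.subgroupOf_sup_zpowers_eq_top {G : Type*} [Group G] {H L : Subgroup G} {t : G}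
    (hHL : H ≤ L) (ht : t ∈ L) (h : H ⊔ Subgroup.zpowers t = L) :
    H.subgroupOf L ⊔ Subgroup.zpowers (⟨t, ht⟩ : L) = ⊤ := by
  refine Subgroup.map_injective L.subtype_injective ?_
  rw [Subgroup.map_sup, Subgroup.subgroupOf_map_subtype, inf_eq_left.2 hHL, MonoidHom.map_zpowers,
    ← MonoidHom.range_eq_map, Subgroup.range_subtype]
  exact h

/-- Polynomial functions separate points on finitely generated torsion-free nilpotent groups. -/
theorem polynomialsSeparate_of_torsionFree {G : Type u} [Group G] [Group.IsNilpotent G]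
    [Group.FG G] (htf : ∀ g : G, ∀ n : ℕ, 0 < n → g ^ n = 1 → g = 1) : PolynomialsSeparate G := by
  have hwf : WellFoundedGT (Subgroup G) :=
    wellFoundedGT_subgroup_of_fg subgroup_fg_of_nilpotent
  -- Induction along ascending subgroups, which terminates by the ascending chain condition:
  -- separation climbs from `H` to `G`, and is then applied to `⊥`.
  have key : ∀ H : Subgroup G, H.Normal → (∀ g : G, ∀ n : ℕ, 0 < n → g ^ n ∈ H → g ∈ H) →
      PolynomialsSeparate H → PolynomialsSeparate G := by
    intro H
    induction H using (wellFounded_gt (α := Subgroup G)).induction with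
    | _ H ih =>
      intro hN hH hsep
      by_cases hne : H = ⊤
      · subst hne
        exact hsep.of_mulEquiv Subgroup.topEquiv.symm
      · obtain ⟨t, htH, hLN, hL⟩ := exists_infinite_cyclic_extension H hH hne
        have hle : H ≤ H ⊔ Subgroup.zpowers t := le_sup_left
        have htL : t ∈ H ⊔ Subgroup.zpowers t :=
          (le_sup_right : _ ≤ H ⊔ Subgroup.zpowers t) (Subgroup.mem_zpowers t)
        refine ih _ (lt_of_le_of_ne hle fun e => htH (e ▸ htL)) hLN hL ?_
        refine PolynomialsSeparate.of_infinite_cyclic_extension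
          (H := H.subgroupOf (H ⊔ Subgroup.zpowers t)) (t := ⟨t, htL⟩) ?_ ?_
          (hsep.of_mulEquiv (Subgroup.subgroupOfEquivOfLe hle))
        · exact Subgroup.subgroupOf_sup_zpowers_eq_top hle htL rfl
        · intro n hn
          have hn' : t ^ n ∈ H := by simpa [Subgroup.mem_subgroupOf] using hn
          by_contra hn0
          refine htH (hH t n.natAbs (Int.natAbs_pos.2 hn0) ?_)
          rw [← zpow_natCast]
          rcases Int.natAbs_eq n with h | h
          · rwa [← h]
          · rw [show ((n.natAbs : ℕ) : ℤ) = -n by omega, zpow_neg]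
            exact inv_mem hn'
  refine key ⊥ inferInstance (fun g n hn hg => ?_) (polynomialsSeparate_of_subsingleton _)
  rw [Subgroup.mem_bot] at *
  exact htf g n hn hg

/-! ### Groups of unipotent elements -/

open Polynomial in
-- A truncated power series for the `k`-th root of `1 + X`. Each step adds the multiple of `X ^ (d +
-- 1)` that cancels the leading error `s.coeff 0`, at the cost of dividing by `k`.
theorem exists_root_polynomial {k : ℕ} (hk : 0 < k) (d : ℕ) :
    ∃ q s : ℚ[X], (1 + X * q) ^ k = 1 + X + X ^ (d + 1) * s := by
  induction d with
  | zero => exact ⟨0, -1, by simp⟩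
  | succ d ih =>
    obtain ⟨q, s, h⟩ := ih
    obtain ⟨r, hr⟩ := Polynomial.powAddExpansion (1 + X * q) (X * (X ^ d * C (-s.coeff 0 / k))) k
    have hk' : (k : ℚ) ≠ 0 := Nat.cast_ne_zero.2 hk.ne'
    obtain ⟨w, hw⟩ : X ∣ (s - C (s.coeff 0) * (1 + X * q) ^ (k - 1)) := by
      rw [X_dvd_iff, coeff_sub, coeff_C_mul, coeff_zero_eq_eval_zero ((1 + X * q) ^ (k - 1))]
      simp
    refine ⟨q + X ^ d * C (-s.coeff 0 / k), w + r * X ^ d * C (-s.coeff 0 / k) ^ 2, ?_⟩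
    have hC : (k : ℚ[X]) * C (-s.coeff 0 / k) = - C (s.coeff 0) := by
      rw [← C_eq_natCast, ← C_mul, ← C_neg]
      congr 1
      field_simp
    rw [mul_add, ← add_assoc, hr, h]
    linear_combination X ^ (d + 1) * hw + X ^ (d + 1) * (1 + X * q) ^ (k - 1) * hC

/-- A descending filtration of a rational algebra whose term of degree `d` vanishes. -/
structure NilpotentFiltration (E : Type u) [Ring E] [Algebra ℚ E] (d : ℕ) where
  toFun : ℕ → Submodule ℚ E
  antitone : Antitone toFun
  one_mem : 1 ∈ toFun 0
  mul_mem : ∀ {i j a b}, a ∈ toFun i → b ∈ toFun j → a * b ∈ toFun (i + j)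
  eq_zero : ∀ {a}, a ∈ toFun d → a = 0

namespace NilpotentFiltration

variable {E : Type u} [Ring E] [Algebra ℚ E] {d : ℕ} (J : NilpotentFiltration E d)

theorem mul_mem_left {i : ℕ} {a b : E} (ha : a ∈ J.toFun 0) (hb : b ∈ J.toFun i) :
    a * b ∈ J.toFun i := by simpa using J.mul_mem ha hb

theorem mul_mem_right {i : ℕ} {a b : E} (ha : a ∈ J.toFun i) (hb : b ∈ J.toFun 0) :
    a * b ∈ J.toFun i := by simpa using J.mul_mem ha hb

theorem pow_mem {a : E} (ha : a ∈ J.toFun 0) (n : ℕ) : a ^ n ∈ J.toFun 0 := by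
  induction n with
  | zero => simpa using J.one_mem
  | succ n ih => rw [pow_succ]; exact J.mul_mem_left ih ha

theorem aeval_mem {a : E} (ha : a ∈ J.toFun 0) (p : Polynomial ℚ) :
    Polynomial.aeval a p ∈ J.toFun 0 := by
  rw [Polynomial.aeval_eq_sum_range]
  exact Submodule.sum_mem _ fun i _ => Submodule.smul_mem _ _ (J.pow_mem ha i)

theorem mem_zero {i : ℕ} {a : E} (ha : a ∈ J.toFun i) : a ∈ J.toFun 0 := J.antitone i.zero_le ha

theorem mem_zero_of_sub_one_mem {i : ℕ} {a : E} (ha : a - 1 ∈ J.toFun i) : a ∈ J.toFun 0 := by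
  simpa using add_mem (J.mem_zero ha) J.one_mem

/-- The units congruent to `1` modulo the term of degree `i` of the filtration. -/
def units (i : ℕ) : Subgroup Eˣ where
  -- The inverse of a unit lying in degree `0` need not lie in degree `0`, hence the second
  -- condition.
  carrier := {u | (u : E) - 1 ∈ J.toFun i ∧ ((u⁻¹ : Eˣ) : E) ∈ J.toFun 0}
  one_mem' := by
    refine ⟨?_, ?_⟩
    · simp
    · simpa using J.one_mem
  mul_mem' := by
    rintro u v ⟨hu, hu'⟩ ⟨hv, hv'⟩
    refine ⟨?_, ?_⟩
    · have : ((u * v : Eˣ) : E) - 1 = u * ((v : E) - 1) + ((u : E) - 1) := by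
        rw [Units.val_mul]; noncomm_ring
      rw [this]
      exact add_mem (J.mul_mem_left (J.mem_zero_of_sub_one_mem hu) hv) hu
    · rw [mul_inv_rev, Units.val_mul]
      exact J.mul_mem_left hv' hu'
  inv_mem' := by
    rintro u ⟨hu, hu'⟩
    refine ⟨?_, ?_⟩
    · have : ((u⁻¹ : Eˣ) : E) - 1 = - (((u⁻¹ : Eˣ) : E) * ((u : E) - 1)) := by
        rw [mul_sub, Units.inv_mul]; noncomm_ring
      rw [this]
      exact neg_mem (J.mul_mem_left hu' hu)
    · rw [inv_inv]
      exact J.mem_zero_of_sub_one_mem hu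

theorem val_mem_zero {i : ℕ} {u : Eˣ} (hu : u ∈ J.units i) : (u : E) ∈ J.toFun 0 :=
  J.mem_zero_of_sub_one_mem hu.1

/-- `⁅u, v⁆ - 1 = (u v - v u) u⁻¹ v⁻¹`, and `u v - v u` is the ring commutator of `u - 1` and `v -
1`. -/
theorem commutator_mem_units {i j : ℕ} {u v : Eˣ} (hu : u ∈ J.units i) (hv : v ∈ J.units j) :
    ⁅u, v⁆ ∈ J.units (i + j) := by
  refine ⟨?_, ?_⟩
  · have : ((⁅u, v⁆ : Eˣ) : E) - 1 =
        (((u : E) - 1) * ((v : E) - 1) - ((v : E) - 1) * ((u : E) - 1)) *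
          (((u⁻¹ : Eˣ) : E) * ((v⁻¹ : Eˣ) : E)) := by
      have h1 : ((u : E) - 1) * ((v : E) - 1) - ((v : E) - 1) * ((u : E) - 1) =
          (u : E) * v - v * u := by noncomm_ring
      have h2 : (v : E) * u * (((u⁻¹ : Eˣ) : E) * ((v⁻¹ : Eˣ) : E)) = 1 := by
        rw [← Units.val_mul, ← Units.val_mul, ← Units.val_mul]
        simp
      rw [h1, sub_mul, h2, commutatorElement_def]
      simp only [Units.val_mul, mul_assoc]
    rw [this]
    refine J.mul_mem_right (sub_mem (J.mul_mem hu.1 hv.1) ?_) (J.mul_mem_left hu.2 hv.2)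
    rw [add_comm]
    exact J.mul_mem hv.1 hu.1
  · rw [commutatorElement_inv, commutatorElement_def]
    simp only [Units.val_mul]
    exact J.mul_mem_left (J.mul_mem_left (J.mul_mem_left (J.val_mem_zero hv) (J.val_mem_zero hu))
      hv.2) hu.2

theorem isNilpotent_units : Group.IsNilpotent (J.units 1) := by
  rw [Subgroup.nilpotent_iff_finite_descending_central_series]
  refine ⟨d, fun n => (J.units (n + 1)).subgroupOf (J.units 1), ⟨?_, ?_⟩, ?_⟩
  · simp
  · rintro ⟨x, hx⟩ n hxn ⟨g, hg⟩
    rw [Subgroup.mem_subgroupOf] at hxn ⊢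
    exact J.commutator_mem_units hxn hg
  · rw [eq_bot_iff]
    rintro ⟨x, hx⟩ hxn
    rw [Subgroup.mem_subgroupOf] at hxn
    rw [Subgroup.mem_bot]
    exact Subtype.ext (Units.ext (sub_eq_zero.1 (J.eq_zero (J.antitone d.le_succ hxn.1))))

/-- For `u = 1 + a`, expanding gives `k a = -r(a) a ^ 2`, so `a` descends the filtration until it
vanishes. -/
theorem eq_one_of_pow_eq_one (u : J.units 1) (k : ℕ) (hk : 0 < k) (h : u ^ k = 1) : u = 1 := by
  obtain ⟨u, hu⟩ := u
  set a : E := (u : E) - 1 with ha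
  have ha1 : a ∈ J.toFun 1 := hu.1
  have hua : (u : E) = 1 + a := by rw [ha]; abel
  obtain ⟨r, hr⟩ := Polynomial.powAddExpansion (1 : Polynomial ℚ) Polynomial.X k
  have h1 : (1 + a) ^ k = 1 := by
    rw [← hua, ← Units.val_pow_eq_pow_val]
    exact congrArg (fun x : J.units 1 => ((x : Eˣ) : E)) h
  have h2 := congrArg (Polynomial.aeval a) hr
  simp only [map_pow, map_add, map_mul, map_one, map_natCast, Polynomial.aeval_X, one_pow,
    mul_one, h1] at h2
  rw [add_assoc, left_eq_add] at h2
  have h3 : a = -((k : ℚ)⁻¹ • (Polynomial.aeval a r * a ^ 2)) := by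
    rw [← eq_neg_iff_add_eq_zero.2 h2 |> fun e => neg_eq_iff_eq_neg.2 e, smul_neg, neg_neg,
      ← nsmul_eq_mul, ← Nat.cast_smul_eq_nsmul ℚ, smul_smul,
      inv_mul_cancel₀ (Nat.cast_ne_zero.2 hk.ne'), one_smul]
  have h4 : ∀ i, a ∈ J.toFun (i + 1) := by
    intro i
    induction i with
    | zero => exact ha1
    | succ i ih =>
      rw [h3]
      refine neg_mem (Submodule.smul_mem _ _ (J.mul_mem_left (J.aeval_mem (J.mem_zero ha1) r) ?_))
      rw [pow_two]
      exact J.mul_mem ih ha1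
  refine Subtype.ext (Units.ext ?_)
  change (u : E) = 1
  rw [hua, J.eq_zero (J.antitone d.le_succ (h4 d)), add_zero]

theorem nilpotent_pow_mem {a : E} (ha : a ∈ J.toFun 1) (n : ℕ) : a ^ n ∈ J.toFun n := by
  induction n with
  | zero => simpa using J.one_mem
  | succ n ih => rw [pow_succ]; exact J.mul_mem ih ha

theorem exists_root (u : J.units 1) (k : ℕ) (hk : 0 < k) : ∃ w : J.units 1, w ^ k = u := by
  obtain ⟨u, hu⟩ := u
  set a : E := (u : E) - 1 with ha
  have ha1 : a ∈ J.toFun 1 := hu.1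
  have hua : (u : E) = 1 + a := by rw [ha]; abel
  obtain ⟨q, s, h⟩ := exists_root_polynomial hk d
  have h1 := congrArg (Polynomial.aeval a) h
  simp only [map_pow, map_add, map_mul, map_one, Polynomial.aeval_X,
    J.eq_zero (J.antitone d.le_succ (J.nilpotent_pow_mem ha1 (d + 1))), zero_mul, add_zero,
    ← hua] at h1
  set b : E := 1 + a * Polynomial.aeval a q with hb
  have hb1 : b - 1 ∈ J.toFun 1 := by
    rw [hb, add_sub_cancel_left]
    exact J.mul_mem_right ha1 (J.aeval_mem (J.mem_zero ha1) q)
  -- Since `u = b ^ k`, the inverse of `b` is `b ^ (k - 1) * u⁻¹`, visibly in degree `0`.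
  have hbu : Commute b u := by rw [← h1]; exact (Commute.refl b).pow_right k
  have e1 : b * (b ^ (k - 1) * ((u⁻¹ : Eˣ) : E)) = 1 := by
    rw [← mul_assoc, ← pow_succ', Nat.sub_add_cancel hk, h1, Units.mul_inv]
  have e2 : (b ^ (k - 1) * ((u⁻¹ : Eˣ) : E)) * b = 1 := by
    rw [mul_assoc, ← hbu.units_inv_right.eq, ← mul_assoc, ← pow_succ, Nat.sub_add_cancel hk, h1,
      Units.mul_inv]
  refine ⟨⟨⟨b, _, e1, e2⟩, hb1, ?_⟩, Subtype.ext (Units.ext ?_)⟩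
  · exact J.mul_mem_left (J.pow_mem (J.mem_zero_of_sub_one_mem hb1) _) hu.2
  · simpa using h1

/-- A group of unipotent elements has a rational Mal'cev completion. -/
theorem exists_isRationalMalcevCompletion {N : Type u} [Group N] (σ : N →* J.units 1)
    (hσ : Function.Injective σ) :
    ∃ (M : Type u) (_ : Group M) (ι : N →* M), IsRationalMalcevCompletion ι := by
  have hnil := J.isNilpotent_units
  -- The ambient unit group already has unique roots; passing to the isolator adds the condition
  -- that powers return to `N`, and a root of an isolated element is isolated.
  refine ⟨isolator σ.range, inferInstance,
    σ.codRestrict _ fun n => ⟨1, one_pos, by simp⟩, inferInstance, ?_, ?_, ?_⟩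
  · refine fun k hk => ⟨fun x y h => Subtype.ext ?_, fun x => ?_⟩
    · exact pow_left_injective_of_torsionFree _ (fun g n hn => J.eq_one_of_pow_eq_one g n hn)
        _ _ k hk (congrArg Subtype.val h)
    · obtain ⟨x, l, hl, hx⟩ := x
      obtain ⟨w, rfl⟩ := J.exists_root x k hk
      exact ⟨⟨w, k * l, Nat.mul_pos hk hl, by rwa [pow_mul]⟩, rfl⟩
  · intro x y h
    exact hσ (congrArg Subtype.val h)
  · rintro ⟨x, k, hk, n, hn⟩
    exact ⟨k, hk, n, Subtype.ext hn⟩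

end NilpotentFiltration

section

variable {V : Type u} [AddCommGroup V] [Module ℚ V]

/-- The endomorphisms lowering the degree of an ascending filtration. -/
def NilpotentFiltration.ofSubmodules (F : ℕ → Submodule ℚ V) (hF : Monotone F) (h0 : F 0 = ⊥)
    {d : ℕ} (hd : F d = ⊤) : NilpotentFiltration (Module.End ℚ V) d where
  toFun j :=
    { carrier := {a | ∀ i, ∀ v ∈ F (i + j), a v ∈ F i}
      add_mem' := fun ha hb i v hv => add_mem (ha i v hv) (hb i v hv)
      zero_mem' := fun i v _ => zero_mem _
      smul_mem' := fun c a ha i v hv => Submodule.smul_mem _ c (ha i v hv) }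
  antitone := fun j k hjk a ha i v hv => ha i v (hF (by omega) hv)
  one_mem := fun i v hv => hv
  mul_mem := fun {j k a b} ha hb i v hv => ha i _ (hb (i + j) v (by rwa [add_assoc]))
  eq_zero := fun {a} ha => by
    ext v
    have := ha 0 v (by rw [zero_add, hd]; trivial)
    rwa [h0, Submodule.mem_bot] at this

end

/-- The action on polynomials of bounded degree is unipotent, and faithful by separation. The finite
filtration is enough; finite dimension of `V` plays no role. -/
theorem PolynomialsSeparate.exists_isRationalMalcevCompletion {N : Type u} [Group N]
    (h : PolynomialsSeparate N) :
    ∃ (M : Type u) (_ : Group M) (ι : N →* M), IsRationalMalcevCompletion ι := by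
  obtain ⟨d, hd⟩ := h
  let ρ := functionRep N N
  let V := unipotentFiltration ρ d
  let σ : N →* Module.End ℚ V :=
    { toFun := fun g => (ρ g).restrict fun v hv => map_mem_unipotentFiltration hv g
      map_one' := by ext v; simp
      map_mul' := fun g h => by ext v; simp }
  let J := NilpotentFiltration.ofSubmodules
    (fun i => (unipotentFiltration ρ i).comap V.subtype)
    (fun i j hij => Submodule.comap_mono (unipotentFiltration_mono hij))
    (by
      rw [eq_bot_iff]
      intro v hv
      exact Subtype.ext ((mem_unipotentFiltration_zero (ρ := ρ)).1 hv))
    (d := d) (by rw [eq_top_iff]; exact fun v _ => v.2)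
  have hσ : ∀ g : N, σ.toHomUnits g ∈ J.units 1 := by
    refine fun g => ⟨?_, ?_⟩
    · intro i v hv
      exact (mem_unipotentFiltration_succ (ρ := ρ) (d := i)).1 hv g
    · intro i v hv
      exact map_mem_unipotentFiltration (ρ := ρ) hv g⁻¹
  refine J.exists_isRationalMalcevCompletion (σ.toHomUnits.codRestrict (J.units 1) hσ) ?_
  · rw [injective_iff_map_eq_one]
    intro g hg
    by_contra hne
    -- The inverse appears because `g` sends `f` to a function with value `f g⁻¹` at `1`.
    obtain ⟨f, hf, hfg⟩ := hd g⁻¹ (inv_ne_one.2 hne)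
    have h1 : σ g = 1 := 
      congrArg (fun x : J.units 1 => ((x : (Module.End ℚ V)ˣ) : Module.End ℚ V)) hg
    have h2 : ρ g f = f := congrArg Subtype.val (LinearMap.congr_fun h1 ⟨f, hf⟩)
    refine hfg ?_
    have h3 := congrFun h2 1
    rw [functionRep_apply] at h3
    simpa using h3

/-- A finitely generated torsion-free nilpotent group `N` has a rational Mal'cev completion, and
for every such completion `M` the abstract commensurator of `N` is isomorphic to `Aut(M)`. -/
theorem theorem9 {N : Type u} [Group N] [Group.FG N] [Group.IsNilpotent N]
    (htf : ∀ g : N, IsOfFinOrder g → g = 1) :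
    (∃ (M : Type u) (_ : Group M) (ι : N →* M), IsRationalMalcevCompletion ι) ∧
    ∀ (M : Type v) [Group M] (ι : N →* M), IsRationalMalcevCompletion ι →
      Nonempty (Comm N ≃* MulAut M) :=
  ⟨(polynomialsSeparate_of_torsionFree fun g n hn hg =>
      htf g (isOfFinOrder_iff_pow_eq_one.2 ⟨n, hn, hg⟩)).exists_isRationalMalcevCompletion,
    fun _ _ _ h => ⟨h.commEquivMulAut⟩⟩
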